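/- Let $d\ge 3$. A set $C\subset\{1,\dots,d\}$ is \emph{admissible} if $C\neq\emptyset$, $|C|\le d/2$, and $1\in C$ whenever $|C|=d/2$. For $C$ admissible, the quartic bubble $Q_C$ is the bipartite edge-coloured graph with white vertices $v,v'$ and black vertices $\bar v,\bar v'$ in which $v\bar v$ and $v'\bar v'$ (the \emph{canonical pairs}) are joined by one edge of each colour $c\notin C$, and $v\bar v'$ and $v'\bar v$ by one edge of each colour $c\in C$. For a family $b=(b_C)$ of non-negative integers indexed by the admissible sets, let $\mathbb G(b)$ be the set of connected graphs obtained from $b_C$ copies of $Q_C$, for all $C$ (with at least one bubble in total), by joining the black vertices bijectively to the white vertices by edges of colour $0$. Let $L_{0c}(G)$ be the number of bicoloured cycles of $G$ with colours $\{0,c\}$. For real scaling coefficients $s=(s_C)$, set $$\delta(G)=\sum_{c=1}^d L_{0c}(G)+\sum_C s_C\,b_C\qquad (G\in\mathbb G(b)),$$ let $\mathbb G_{\max}(b)$ be the set of the $G\in\mathbb G(b)$ that maximize $\delta$ on $\mathbb G(b)$, and let $\delta_{\max}$ be the maximum of $\delta$ over all graphs with all possible $b$. A \emph{large-$N$ limit}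 exists if $\delta_{\max}$ exists (is finite); it is \emph{non-trivial} if, moreover, for every admissible $C$ there are graphs with $\delta(G)=\delta_{\max}$ and with $b_C$ arbitrarily large. The intermediate field map $J(G)$ of $G\in\mathbb G(b)$ is the combinatorial map whose half-edges are the canonical pairs of the bubbles of $G$; whose edges are the bubbles, a bubble $Q_C$ giving an edge $e$, decorated by $C_e=C$, that consists of its two canonical pairs; and whose vertices, with their cyclic orders, are given by the rule that a pair $\{v,\bar v\}$ is followed by the pair that contains the white end of the edge of colour $0$ at $\bar v$. Let $\mathbb M(b)$ be the set of connected combinatorial maps, up to isomorphism, with edges decorated by admissible colour sets such that each $C$ decorates exactly $b_C$ edges (with at least one edge), and let $\mathbb M_{\max}(b)=J(\mathbb G_{\max}(b))$. For $M\in\mathbb M(b)$, let $M_C$ be the submap of $M$ with the same vertices and only the edges decorated by $C$; a map is called planar if all its connected components have genus zero. \textbf{Theorem.} \begin{enumerate} \item There is a non-trivial large-$N$ limit if and only if $s_C=|C|-d$ for all admissible $C$. \item In that case $\delta_{\max}=d$, and $\delta(G)=d$ for all $b$ and all $G\in\mathbb G_{\max}(b)$. \item For all $s$ and $b$, $\mathbb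 M_{\max}(b)$ is exactly the set of the maps $M\in\mathbb M(b)$ such that \begin{itemize} \item $M$ is planar; \item every edge $e$ with $|C_e|<d/2$ is a bridge; \item $M_C$ is planar for every admissible $C$; \item for $C\ne C'$, $M_C$ and $M_{C'}$ meet only at cut-vertices: if an edge $e$ of $M_C$ and an edge $e'$ of $M_{C'}$ are incident to a common vertex $v$, then $v$ is a cut-vertex of $M$ that separates $e$ from $e'$, i.e. the edges of $M$ can be partitioned into two classes, one containing $e$ and the other $e'$, such that no vertex other than $v$ is incident to edges of both classes. \end{itemize} \end{enumerate} -/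

import Mathlib

namespace QuarticTensor

/-! ### Admissible colour sets -/

/-- The colours `1, …, d` of the text are the elements of `Fin d`; the colour `1` is the element of
value `0`. A set `C` of colours is admissible if `C ≠ ∅` (the bubble `Q_C` is connected),
`|C| ≤ d / 2`, and `1 ∈ C` when `|C| = d / 2`. -/
def IsAdmissible {d : ℕ} (C : Finset (Fin d)) : Prop :=
  C.Nonempty ∧ 2 * C.card ≤ d ∧ (2 * C.card = d → ∃ c ∈ C, (c : ℕ) = 0)

instance {d : ℕ} (C : Finset (Fin d)) : Decidable (IsAdmissible C) := by
  unfold IsAdmissible; infer_instance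

/-- The finite set of admissible colour sets. -/
abbrev ColorSet (d : ℕ) : Type := {C : Finset (Fin d) // IsAdmissible C}

/-! ### Coloured graphs, quartic bubbles and Feynman graphs -/

/-- A bipartite multigraph with white vertices `W` and black vertices `B`, whose edges carry
colours in `K`, every colour being incident exactly once to every vertex: the edges of colour `k`
are the pairs `(w, edge k w)`. -/
structure ColoredGraph (K W B : Type) where
  edge : K → W ≃ B

/-- The underlying simple graph of the subgraph that keeps the edges with colours in `S`. -/
def ColoredGraph.restrict {K W B : Type} (X : ColoredGraph K W B) (S : Set K) :
    SimpleGraph (W ⊕ B) :=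
  SimpleGraph.fromRel fun x y => ∃ k ∈ S, ∃ w : W, x = Sum.inl w ∧ y = Sum.inr (X.edge k w)

/-- The quartic bubble `Q_C`: two white vertices, two black vertices. The white vertex `ε` is joined
to the black vertex `ε` (its canonical partner) by the colours not in `C`, and to the other
black vertex by the colours in `C`. -/
def quarticBubble {d : ℕ} (C : Finset (Fin d)) : ColoredGraph (Fin d) Bool Bool where
  edge c := if c ∈ C then Equiv.boolNot else Equiv.refl Bool

/-- A collection of bubbles made of `b C` copies of `Q_C` for every admissible `C`. -/
abbrev Bubble {d : ℕ} (b : ColorSet d → ℕ) : Type := Σ C : ColorSet d, Fin (b C)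

/-- The white vertices of that collection, and likewise the black ones. The white vertex `(i, ε)`
and the black vertex `(i, ε)` are a canonical pair of the bubble `i`, so that `BubbleVertex b`
also indexes the canonical pairs. -/
abbrev BubbleVertex {d : ℕ} (b : ColorSet d → ℕ) : Type := Bubble b × Bool

/-- The graph obtained from the collection of bubbles by Wick contractions, each of which joins a
black vertex `x` to the white vertex `wick x` by an edge of colour `0`. The colour `0` is `none`,
the colours of the bubbles are `some c`. -/
def wickGraph {d : ℕ} {b : ColorSet d → ℕ} (wick : BubbleVertex b ≃ BubbleVertex b) :
    ColoredGraph (Option (Fin d)) (BubbleVertex b) (BubbleVertex b) where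
  edge
    | none => wick.symm
    | some c => Equiv.prodShear (Equiv.refl (Bubble b)) fun i => (quarticBubble i.1.1).edge c

/-- The set `𝔾({b_C, Q_C})` of connected Feynman graphs with `b C` bubbles `Q_C`. -/
structure FeynmanGraph {d : ℕ} (b : ColorSet d → ℕ) where
  /-- the Wick contractions, from black to white vertices -/
  wick : BubbleVertex b ≃ BubbleVertex b
  connected : ((wickGraph wick).restrict Set.univ).Connected

/-- The number `L_{0c}(G)` of bicoloured cycles with colours `0` and `c`, that is, of connected
components of the (2-regular) subgraph made of the edges of these two colours. -/
noncomputable def FeynmanGraph.bicoloredCycles {d : ℕ} {b : ColorSet d → ℕ}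
    (G : FeynmanGraph b) (c : Fin d) : ℕ :=
  Nat.card ((wickGraph G.wick).restrict {none, some c}).ConnectedComponent

/-- The exponent `δ(G) = ∑_c L_{0c}(G) + ∑_C s_C b_C` of `N` in the amplitude of `G`. -/
noncomputable def delta {d : ℕ} (s : ColorSet d → ℝ) {b : ColorSet d → ℕ}
    (G : FeynmanGraph b) : ℝ :=
  ∑ c : Fin d, (G.bicoloredCycles c : ℝ) + ∑ C : ColorSet d, s C * (b C : ℝ)

/-- `q` is `δ_max`, the maximum of `δ` over all Feynman graphs with any numbers of bubbles. A
large `N` limit exists if there is such a `q`. -/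
def IsDeltaMax {d : ℕ} (s : ColorSet d → ℝ) (q : ℝ) : Prop :=
  IsGreatest {x : ℝ | ∃ (b : ColorSet d → ℕ) (G : FeynmanGraph b), delta s G = x} q

/-- A large `N` limit exists, and it is non-trivial: for every `C`, among the graphs of the leading
order, i.e. those with `δ(G) = δ_max`, there are graphs with arbitrarily many bubbles `Q_C`. -/
def HasNontrivialLargeNLimit {d : ℕ} (s : ColorSet d → ℝ) : Prop :=
  ∃ q : ℝ, IsDeltaMax s q ∧
    ∀ (C : ColorSet d) (n : ℕ), ∃ (b : ColorSet d → ℕ) (G : FeynmanGraph b),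
      n ≤ b C ∧ delta s G = q

/-- The set `𝔾_max({b_C, Q_C})` of graphs which maximize `δ` at fixed numbers of bubbles. -/
def graphMax {d : ℕ} (s : ColorSet d → ℝ) (b : ColorSet d → ℕ) : Set (FeynmanGraph b) :=
  {G | ∀ G' : FeynmanGraph b, delta s G' ≤ delta s G}

/-! ### Combinatorial maps -/

/-- A combinatorial map with half-edges `H`, possibly with legs: `σ` sends a half-edge to the next
one around its vertex, `α` to the other half of its edge. A half-edge that `α` fixes is a leg,
i.e. a mark in a corner of the map that is not part of any edge. -/
structure CombMap (H : Type*) where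
  σ : Equiv.Perm H
  α : Equiv.Perm H
  α_α : ∀ h, α (α h) = h

namespace CombMap

variable {H : Type*} (M : CombMap H)

/-- Two half-edges are incident to the same vertex. -/
def SameVertex (h h' : H) : Prop := M.σ.SameCycle h h'

/-- Two half-edges lie in the same connected component. -/
def SameComponent (h h' : H) : Prop := ∃ g ∈ Subgroup.closure {M.σ, M.α}, g h = h'

/-- The vertices are the cycles of `σ`. -/
noncomputable def numVertices : ℕ := Nat.card (Quotient (Equiv.Perm.SameCycle.setoid M.σ))

/-- The edges are the cycles of `α` of length two. -/
noncomputable def numEdges : ℕ := {e : Set H | ∃ h, M.α h ≠ h ∧ e = {h, M.α h}}.ncard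

/-- The faces are the closed paths that follow alternatingly edges and corners (and cross the legs),
i.e. the cycles of `σ * α`. -/
noncomputable def numFaces : ℕ := Nat.card (Quotient (Equiv.Perm.SameCycle.setoid (M.σ * M.α)))

/-- The number of connected components. -/
noncomputable def numComponents : ℕ :=
  Nat.card (MulAction.orbitRel.Quotient (Subgroup.closure {M.σ, M.α}) H)

/-- Planarity: `V - E + F = 2 K`, i.e. all the components have genus zero. -/
def IsPlanar : Prop := M.numVertices + M.numFaces = M.numEdges + 2 * M.numComponents

/-- The map is connected (in particular it has at least one half-edge). -/
def IsConnected : Prop := M.numComponents = 1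

open Classical in
theorem keep_involutive (p : H → Prop) (hp : ∀ h, p (M.α h) ↔ p h) :
    Function.Involutive fun h => if p h then M.α h else h := by
  intro h
  by_cases h1 : p h
  · simp [h1, (hp h).2 h1, M.α_α]
  · simp [h1]

open Classical in
/-- The submap which has the same vertices and only the edges whose half-edges satisfy `p`. The
half-edges of the deleted edges stay as legs, so that a vertex which loses all its edges is still
there, as an isolated vertex with a single face. -/
noncomputable def keep (p : H → Prop) (hp : ∀ h, p (M.α h) ↔ p h) : CombMap H where
  σ := M.σ
  α := (M.keep_involutive p hp).toPerm
  α_α := M.keep_involutive p hp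

/-- The map without the edge `{h, α h}`. -/
noncomputable def deleteEdge (h : H) : CombMap H :=
  M.keep (fun g => g ≠ h ∧ g ≠ M.α h) (by
    intro g
    constructor
    · rintro ⟨h1, h2⟩
      refine ⟨fun e => h2 (by rw [e]), fun e => h1 ?_⟩
      rw [e, M.α_α]
    · rintro ⟨h1, h2⟩
      refine ⟨fun e => h2 ?_, fun e => h1 (M.α.injective e)⟩
      rw [← e, M.α_α])

/-- The edge `{h, α h}` is a bridge: without it, its two ends are in different components. -/
def IsBridge (h : H) : Prop := ¬ (M.deleteEdge h).SameComponent h (M.α h)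

/-- The common vertex `v` of the half-edges `h` and `h'` is a cut-vertex which separates their edges:
the edges fall into two classes, one with the edge of `h`, the other with the edge of `h'`, and
`v` is the only vertex at which edges of both classes meet. -/
def SeparatedByCutVertex (h h' : H) : Prop :=
  M.SameVertex h h' ∧ ∃ S : Set H, (∀ g, M.α g ∈ S ↔ g ∈ S) ∧ h ∈ S ∧ h' ∉ S ∧
    ∀ g ∈ S, ∀ g' ∉ S, M.SameVertex g g' → M.SameVertex h g

end CombMap

/-- A combinatorial map (without legs) whose edges are decorated by admissible colour sets. -/
structure DecoratedMap (d : ℕ) (H : Type*) extends CombMap H where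
  α_ne : ∀ h, α h ≠ h
  color : H → ColorSet d
  color_α : ∀ h, color (α h) = color h

namespace DecoratedMap

variable {d : ℕ} {H : Type*}

/-- The submap `M_C` of the edges with colour set `C`. -/
noncomputable def colorSubmap (M : DecoratedMap d H) (C : ColorSet d) : CombMap H :=
  M.toCombMap.keep (fun h => M.color h = C) (fun h => by rw [M.color_α])

/-- Isomorphism of decorated maps, i.e. relabelling of the half-edges. -/
def Isomorphic {H' : Type*} (M : DecoratedMap d H) (M' : DecoratedMap d H') : Prop :=
  ∃ f : H ≃ H', (∀ h, f (M.σ h) = M'.σ (f h)) ∧ (∀ h, f (M.α h) = M'.α (f h)) ∧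
    ∀ h, M'.color (f h) = M.color h

/-- The submaps `M_C` and `M_{C'}`, for `C ≠ C'`, can only meet at cut-vertices (which separate the
`C`-edges from the `C'`-edges that meet there). -/
def MeetOnlyAtCutVertices (M : DecoratedMap d H) (C C' : ColorSet d) : Prop :=
  ∀ h h' : H, M.color h = C → M.color h' = C' → M.SameVertex h h' → M.SeparatedByCutVertex h h'

end DecoratedMap

/-- The set `𝕄({b_C})` of connected decorated maps in which `C` appears on `b C` edges. -/
def mapSet {d : ℕ} (b : ColorSet d → ℕ) (H : Type*) : Set (DecoratedMap d H) :=
  {M | M.IsConnected ∧ ∀ C : ColorSet d, (M.colorSubmap C).numEdges = b C}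

/-- The intermediate field map `J(G)`. Its half-edges are the canonical pairs `{v, v̄}`; its edges are
the bubbles, i.e. `α` exchanges the two canonical pairs of a bubble; and `σ` goes from the pair
`{v, v̄}` along the edge of colour `0` at its black vertex to the pair of the white vertex there. -/
def intermediateField {d : ℕ} {b : ColorSet d → ℕ} (G : FeynmanGraph b) :
    DecoratedMap d (BubbleVertex b) where
  σ := G.wick
  α := Equiv.prodCongr (Equiv.refl (Bubble b)) Equiv.boolNot
  α_α := fun x => Prod.ext rfl (Bool.not_not x.2)
  α_ne := fun x e => Bool.not_ne_self x.2 (congrArg Prod.snd e)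
  color x := x.1.1
  color_α _ := rfl

/-- The set `𝕄_max({b_C}) = J(𝔾_max({b_C, Q_C}))`, up to the names of the half-edges. -/
def mapMax {d : ℕ} (s : ColorSet d → ℝ) (b : ColorSet d → ℕ) (H : Type*) :
    Set (DecoratedMap d H) :=
  {M | ∃ G ∈ graphMax s b, (intermediateField G).Isomorphic M}

end QuarticTensor

/-! Through the intermediate field, a cycle of colours `0`, `c` becomes a face of the submap of the
edges whose colour set contains `c`. Let `β = E + K - V` be the cycle rank of a submap (`K`
components) and `E + 2K - V - F` its `excess`, twice the sum of the genera. Counting faces by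
Euler's formula gives, for a connected map with `b C` edges of colour set `C`, `δ = d + ∑ C, (s C -
(|C| - d)) * b C - defect - ∑ c, excess c`, where `defect = d β(M) - 2 ∑ c, β(M restricted to c)`
(`delta_eq`).

Both error terms start at zero on the map without edges and are monotone under adding edges. For the
excess, adding an edge multiplies the face permutation by a transposition. For the defect, an edge
that closes a cycle costs `d` and regains `2` for each of its colours in whose submap it also closes
a cycle, hence at most `2|C| ≤ d`. So `δ` is at most its affine part. The bound is attained for
every nonzero `b` by a star, all of whose edges are bridges; thus the maximizers at fixed `b` are
the maps where both terms vanish, whatever `s` is. The scaling statements follow by comparing the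
affine bounds at different `b`.

It remains to read off the vanishing (`leading_iff`). Zero defect is inherited by every set of
edges, so any edge may be taken as the last one added: if it is not a bridge, then `|C| = d/2`, and
its ends are linked through edges containing `c` for each of its colours `c`. This forces distinct
colour sets apart at cut-vertices (`separatedByCutVertex_of_mem_of_notMem`). Conversely,
cut-vertices make every minimal cycle monochromatic in `C`
(`conn_colored_of_meetOnlyAtCutVertices`), so that each edge closing a cycle regains exactly its
cost. The genera of the whole map and of the submap of colour `1` agree, since all edges without
colour `1` are bridges. -/

namespace QuarticTensor

/-! ### Cycles of a permutation multiplied by a transposition -/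

section Generic

variable {H : Type*}

/-- Gluing the two distinct classes of `a` and `b` lowers the number of classes by one. -/
theorem card_quotient_glue [Finite H] (r r' : Setoid H) (a b : H) (hab : ¬ r a b)
    (hr : ∀ x y, r' x y ↔ r x y ∨ (r x a ∧ r b y) ∨ (r x b ∧ r a y)) :
    Nat.card (Quotient r) = Nat.card (Quotient r') + 1 := by
  classical
  have hle : ∀ x y, r x y → r' x y := fun x y h => (hr x y).2 (Or.inl h)
  -- Each class of `r'` contains exactly one class of `r` other than that of `b`: the glued class is
  -- represented by that of `a`.
  let φ : {q : Quotient r // q ≠ Quotient.mk r b} → Quotient r' :=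
    fun q => Quotient.map' (s₁ := r) (s₂ := r') id (fun x y h => hle x y h) q.1
  have hφ : Function.Bijective φ := by
    constructor
    · rintro ⟨q, hq⟩ ⟨q', hq'⟩ h
      induction q using Quotient.inductionOn with | _ x
      induction q' using Quotient.inductionOn with | _ y
      have hx : ¬ r x b := fun h => hq (Quotient.sound h)
      have hy : ¬ r y b := fun h => hq' (Quotient.sound h)
      have h' : r' x y := Quotient.exact h
      rcases (hr x y).1 h' with h1 | ⟨_, h1⟩ | ⟨h1, _⟩
      · exact Subtype.ext (Quotient.sound h1)
      · exact (hy (r.symm h1)).elim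
      · exact (hx h1).elim
    · intro q
      induction q using Quotient.inductionOn with | _ x
      by_cases hx : r x b
      · refine ⟨⟨Quotient.mk r a, fun h => hab (Quotient.exact h)⟩, ?_⟩
        exact Quotient.sound ((hr a x).2 (Or.inr (Or.inl ⟨r.refl a, r.symm hx⟩)))
      · exact ⟨⟨Quotient.mk r x, fun h => hx (Quotient.exact h)⟩, rfl⟩
  rw [← Nat.card_congr (Equiv.ofBijective φ hφ)]
  have := Set.ncard_add_ncard_compl {Quotient.mk r b}
  rw [Set.ncard_singleton] at this
  rw [← this, add_comm]
  rfl

/-- On a finite type the inverse of `π` is a power of `π`, so forward invariance suffices. -/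
theorem perm_mem_iff [Finite H] (π : Equiv.Perm H) (I : H → Prop) (hI : ∀ x, I x → I (π x))
    (x : H) : I (π x) ↔ I x := by
  refine ⟨fun h => ?_, hI x⟩
  have hn : ∀ n : ℕ, ∀ y, I y → I ((π ^ n) y) := by
    intro n
    induction n with
    | zero => intro y hy; simpa using hy
    | succ n ih => intro y hy; rw [pow_succ']; exact hI _ (ih y hy)
  have h1 := hn (orderOf π - 1) _ h
  have h2 : (π ^ (orderOf π - 1)) (π x) = x := by
    rw [← Equiv.Perm.mul_apply, ← pow_succ, Nat.sub_add_cancel (orderOf_pos π), pow_orderOf_eq_one]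
    rfl
  rwa [h2] at h1

/-- A property that is preserved by `π` holds on whole cycles of `π`. -/
theorem sameCycle_induction [Finite H] (π : Equiv.Perm H) (I : H → Prop)
    (hI : ∀ x, I x → I (π x)) {x y : H} (hxy : π.SameCycle x y) (hx : I x) : I y := by
  obtain ⟨n, -, rfl⟩ := hxy.exists_pow_eq'
  clear hxy
  induction n with
  | zero => simpa using hx
  | succ n ih => rw [pow_succ']; exact hI _ ih

theorem sameCycle_apply_self (π : Equiv.Perm H) (x : H) : π.SameCycle x (π x) := ⟨1, by simp⟩

variable [DecidableEq H]

theorem mul_swap_cases (π : Equiv.Perm H) (a b x : H) :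
    (x = a ∧ (π * Equiv.swap a b) x = π b) ∨ (x = b ∧ (π * Equiv.swap a b) x = π a) ∨
      (x ≠ a ∧ x ≠ b ∧ (π * Equiv.swap a b) x = π x) := by
  by_cases ha : x = a
  · left; simp [ha]
  by_cases hb : x = b
  · right; left; simp [hb]
  · right; right; simp [ha, hb, Equiv.swap_apply_of_ne_of_ne ha hb]

/-- The product with a transposition separates two points that lie in the same cycle. -/
theorem not_sameCycle_mul_swap [Finite H] (π : Equiv.Perm H) {a b : H} (hab : a ≠ b)
    (h : π.SameCycle a b) : ¬ (π * Equiv.swap a b).SameCycle a b := by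
  classical
  have hex : ∃ n : ℕ, 0 < n ∧ (π ^ n) a = b := by
    obtain ⟨n, hn, -, h⟩ := h.exists_pow_eq''
    exact ⟨n, hn, h⟩
  have hk := Nat.find_spec hex
  have hmin : ∀ m, 0 < m → m < Nat.find hex → (π ^ m) a ≠ b :=
    fun m h0 hm h => Nat.find_min hex hm ⟨h0, h⟩
  set k := Nat.find hex
  -- The orbit of `a` cannot return to `a` before it reaches `b`: otherwise it would have reached
  -- `b` sooner.
  have hna : ∀ j, 0 < j → j ≤ k → (π ^ j) a ≠ a := by
    intro j h0 hj e
    rcases hj.lt_or_eq with hlt | rfl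
    · refine hmin (k - j) (by omega) (by omega) ?_
      have : (π ^ (k - j)) ((π ^ j) a) = b := by
        rw [← Equiv.Perm.mul_apply, ← pow_add, Nat.sub_add_cancel hj]; exact hk.2
      rwa [e] at this
    · exact hab (e.symm.trans hk.2)
  intro hs
  -- The product sends `b` to `π a` and then follows `π`, so its cycle through `b` stays in the arc
  -- `π a, …, π ^ k a = b`, which avoids `a`.
  have key : ∃ j, 0 < j ∧ j ≤ k ∧ (π ^ j) a = a := by
    refine sameCycle_induction (π * Equiv.swap a b)
      (fun x => ∃ j, 0 < j ∧ j ≤ k ∧ (π ^ j) a = x) ?_ hs.symm ⟨k, hk.1, le_rfl, hk.2⟩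
    rintro x ⟨j, h0, hj, rfl⟩
    rcases mul_swap_cases π a b ((π ^ j) a) with ⟨h1, -⟩ | ⟨-, h2⟩ | ⟨-, h1, h2⟩
    · exact (hna j h0 hj h1).elim
    · exact ⟨1, one_pos, hk.1, by rw [h2, pow_one]⟩
    · refine ⟨j + 1, by omega, ?_, by rw [h2, pow_succ', Equiv.Perm.mul_apply]⟩
      rcases hj.lt_or_eq with hlt | rfl
      · exact hlt
      · exact (h1 hk.2).elim
  obtain ⟨j, h0, hj, h⟩ := key
  exact hna j h0 hj h

/-- The product with a transposition joins two points that lie in different cycles. -/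
theorem sameCycle_mul_swap [Finite H] (π : Equiv.Perm H) {a b : H}
    (h : ¬ π.SameCycle a b) : (π * Equiv.swap a b).SameCycle a b := by
  classical
  by_contra hs
  -- Starting from `b` the product jumps to `π a` and follows the old cycle of `a`; that cycle
  -- misses `b`, so the walk ends up at `a`.
  have hstep : ∀ x, (π.SameCycle a x ∧ (π * Equiv.swap a b).SameCycle b x) →
      (π.SameCycle a (π x) ∧ (π * Equiv.swap a b).SameCycle b (π x)) := by
    rintro x ⟨h1, h2⟩
    refine ⟨h1.trans (sameCycle_apply_self π x), ?_⟩
    rcases mul_swap_cases π a b x with ⟨rfl, -⟩ | ⟨rfl, -⟩ | ⟨-, -, h3⟩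
    · exact (hs h2.symm).elim
    · exact (h h1).elim
    · rw [← h3]; exact h2.trans (sameCycle_apply_self _ x)
  have h0 : π.SameCycle a (π a) ∧ (π * Equiv.swap a b).SameCycle b (π a) := by
    refine ⟨sameCycle_apply_self π a, ?_⟩
    have := sameCycle_apply_self (π * Equiv.swap a b) b
    simpa using this
  have := sameCycle_induction π _ hstep (sameCycle_apply_self π a).symm h0
  exact hs this.2.symm

theorem card_cycles_mul_swap_of_not_sameCycle [Finite H] (π : Equiv.Perm H) {a b : H}
    (h : ¬ π.SameCycle a b) :
    Nat.card (Quotient (Equiv.Perm.SameCycle.setoid π)) =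
      Nat.card (Quotient (Equiv.Perm.SameCycle.setoid (π * Equiv.swap a b))) + 1 := by
  have hs := sameCycle_mul_swap π h
  refine card_quotient_glue _ _ a b h fun x y => ?_
  change (π * Equiv.swap a b).SameCycle x y ↔ π.SameCycle x y ∨
    (π.SameCycle x a ∧ π.SameCycle b y) ∨ (π.SameCycle x b ∧ π.SameCycle a y)
  have hle : ∀ x y, π.SameCycle x y → (π * Equiv.swap a b).SameCycle x y := by
    intro x y hxy
    refine sameCycle_induction π (fun z => (π * Equiv.swap a b).SameCycle x z) ?_ hxy
      (Equiv.Perm.SameCycle.refl _ _)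
    intro z hz
    refine hz.trans ?_
    rcases mul_swap_cases π a b z with ⟨rfl, -⟩ | ⟨rfl, -⟩ | ⟨-, -, h3⟩
    · have := sameCycle_apply_self (π * Equiv.swap z b) b
      rw [Equiv.Perm.mul_apply, Equiv.swap_apply_right] at this
      exact hs.trans this
    · have := sameCycle_apply_self (π * Equiv.swap a z) a
      rw [Equiv.Perm.mul_apply, Equiv.swap_apply_left] at this
      exact hs.symm.trans this
    · rw [← h3]; exact sameCycle_apply_self _ z
  constructor
  · intro hxy
    refine sameCycle_induction (π * Equiv.swap a b) (fun y => π.SameCycle x y ∨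
      (π.SameCycle x a ∧ π.SameCycle b y) ∨ (π.SameCycle x b ∧ π.SameCycle a y)) ?_ hxy
      (Or.inl (Equiv.Perm.SameCycle.refl _ _))
    intro z hz
    rcases mul_swap_cases π a b z with ⟨rfl, h3⟩ | ⟨rfl, h3⟩ | ⟨-, -, h3⟩
    · rw [h3]
      rcases hz with hz | ⟨_, hz⟩ | ⟨hz, _⟩
      · exact Or.inr (Or.inl ⟨hz, sameCycle_apply_self π b⟩)
      · exact (h hz.symm).elim
      · exact Or.inl (hz.trans (sameCycle_apply_self π b))
    · rw [h3]
      rcases hz with hz | ⟨hz, _⟩ | ⟨_, hz⟩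
      · exact Or.inr (Or.inr ⟨hz, sameCycle_apply_self π a⟩)
      · exact Or.inl (hz.trans (sameCycle_apply_self π a))
      · exact (h hz).elim
    · rw [h3]
      have := sameCycle_apply_self π z
      rcases hz with hz | ⟨h1, hz⟩ | ⟨h1, hz⟩
      · exact Or.inl (hz.trans this)
      · exact Or.inr (Or.inl ⟨h1, hz.trans this⟩)
      · exact Or.inr (Or.inr ⟨h1, hz.trans this⟩)
  · rintro (h1 | ⟨h1, h2⟩ | ⟨h1, h2⟩)
    · exact hle _ _ h1
    · exact (hle _ _ h1).trans (hs.trans (hle _ _ h2))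
    · exact (hle _ _ h1).trans (hs.symm.trans (hle _ _ h2))

theorem card_cycles_mul_swap_of_sameCycle [Finite H] (π : Equiv.Perm H) {a b : H} (hab : a ≠ b)
    (h : π.SameCycle a b) :
    Nat.card (Quotient (Equiv.Perm.SameCycle.setoid (π * Equiv.swap a b))) =
      Nat.card (Quotient (Equiv.Perm.SameCycle.setoid π)) + 1 := by
  have := card_cycles_mul_swap_of_not_sameCycle _ (not_sameCycle_mul_swap π hab h)
  rwa [mul_assoc, Equiv.swap_mul_self, mul_one] at this

end Generic

/-! ### Connectivity and submaps -/

namespace CombMap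

variable {H : Type*} (M : CombMap H)

theorem SameComponent.refl (x : H) : M.SameComponent x x := ⟨1, one_mem _, rfl⟩

variable {M} in
theorem SameComponent.symm {x y : H} (h : M.SameComponent x y) : M.SameComponent y x := by
  obtain ⟨g, hg, rfl⟩ := h
  exact ⟨g⁻¹, inv_mem hg, by simp⟩

variable {M} in
theorem SameComponent.trans {x y z : H} (h : M.SameComponent x y) (h' : M.SameComponent y z) :
    M.SameComponent x z := by
  obtain ⟨g, hg, rfl⟩ := h
  obtain ⟨g', hg', rfl⟩ := h'
  exact ⟨g' * g, mul_mem hg' hg, rfl⟩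

theorem sameComponent_σ (x : H) : M.SameComponent x (M.σ x) :=
  ⟨M.σ, Subgroup.subset_closure (by simp), rfl⟩

theorem sameComponent_α (x : H) : M.SameComponent x (M.α x) :=
  ⟨M.α, Subgroup.subset_closure (by simp), rfl⟩

variable {M} in
theorem SameVertex.sameComponent {x y : H} (h : M.SameVertex x y) : M.SameComponent x y := by
  obtain ⟨n, rfl⟩ := h
  exact ⟨M.σ ^ n, Subgroup.zpow_mem _ (Subgroup.subset_closure (by simp)) n, rfl⟩

/-- A property that is preserved by `σ` and `α` holds on whole components. -/
theorem sameComponent_induction [Finite H] (I : H → Prop) (hσ : ∀ x, I x → I (M.σ x))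
    (hα : ∀ x, I x → I (M.α x)) {x y : H} (h : M.SameComponent x y) (hx : I x) : I y := by
  obtain ⟨g, hg, rfl⟩ := h
  have key : ∀ x, I (g x) ↔ I x := by
    induction hg using Subgroup.closure_induction with
    | mem g hg =>
      rcases hg with rfl | rfl
      · exact perm_mem_iff _ I hσ
      · exact perm_mem_iff _ I hα
    | one => intro x; rfl
    | mul g g' _ _ h h' => intro x; rw [Equiv.Perm.mul_apply, h, h']
    | inv g _ h => intro x; rw [← h]; simp
  exact (key x).2 hx

/-- Connectivity, as an equivalence relation on the half-edges. -/
def componentSetoid : Setoid H where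
  r := M.SameComponent
  iseqv := ⟨SameComponent.refl M, SameComponent.symm, SameComponent.trans⟩

theorem numComponents_eq : M.numComponents = Nat.card (Quotient M.componentSetoid) := by
  refine Nat.card_congr (Quotient.congr (Equiv.refl H) fun x y => ?_)
  rw [MulAction.orbitRel_apply]
  constructor
  · rintro ⟨⟨g, hg⟩, h⟩
    exact SameComponent.symm ⟨g, hg, h⟩
  · intro h
    obtain ⟨g, hg, h⟩ := SameComponent.symm h
    exact ⟨⟨g, hg⟩, h⟩

theorem isConnected_iff [Finite H] :
    M.IsConnected ↔ Nonempty H ∧ ∀ x y, M.SameComponent x y := by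
  rw [IsConnected, numComponents_eq, Nat.card_eq_one_iff_unique]
  constructor
  · rintro ⟨h1, ⟨q⟩⟩
    induction q using Quotient.inductionOn with | _ x
    exact ⟨⟨x⟩, fun x y => Quotient.exact (h1.elim (Quotient.mk M.componentSetoid x)
      (Quotient.mk M.componentSetoid y))⟩
  · rintro ⟨⟨x⟩, h⟩
    refine ⟨⟨fun p q => ?_⟩, ⟨Quotient.mk _ x⟩⟩
    induction p using Quotient.inductionOn with | _ x
    induction q using Quotient.inductionOn with | _ y
    exact Quotient.sound (h x y)

/-- The submap with the edges whose two half-edges lie in `P`. -/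
noncomputable def sub (P : Set H) : CombMap H :=
  M.keep (fun h => h ∈ P ∧ M.α h ∈ P) fun h => by rw [M.α_α]; exact and_comm

/-- A set of half-edges that is a union of edges and legs. -/
def EdgeClosed (P : Set H) : Prop := ∀ h, M.α h ∈ P ↔ h ∈ P

theorem eq_of_σ_α {M N : CombMap H} (h : M.σ = N.σ) (h' : M.α = N.α) : M = N := by
  cases M; cases N; cases h; cases h'; rfl

theorem keep_eq_sub (p : H → Prop) (hp : ∀ h, p (M.α h) ↔ p h) :
    M.keep p hp = M.sub {h | p h} := by
  refine eq_of_σ_α rfl (Equiv.ext fun h => ?_)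
  by_cases hh : p h
  · exact (if_pos hh).trans (if_pos ⟨hh, (hp h).2 hh⟩).symm
  · exact (if_neg hh).trans (if_neg fun h' => hh h'.1).symm

variable {M} {P : Set H}

theorem sub_α_of_mem (hP : M.EdgeClosed P) {h : H} (hh : h ∈ P) : (M.sub P).α h = M.α h := by
  classical
  exact if_pos ⟨hh, (hP h).2 hh⟩

theorem sub_α_of_notMem {h : H} (hh : h ∉ P) : (M.sub P).α h = h := by
  classical
  exact if_neg fun h' => hh h'.1

theorem sub_univ : M.sub Set.univ = M :=
  eq_of_σ_α rfl (Equiv.ext fun _ => sub_α_of_mem (fun _ => Iff.rfl) trivial)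

theorem EdgeClosed.univ : M.EdgeClosed Set.univ := fun _ => Iff.rfl

theorem EdgeClosed.empty : M.EdgeClosed ∅ := fun _ => Iff.rfl

theorem EdgeClosed.inter {Q : Set H} (hP : M.EdgeClosed P) (hQ : M.EdgeClosed Q) :
    M.EdgeClosed (P ∩ Q) := fun h => and_congr (hP h) (hQ h)

theorem EdgeClosed.compl (hP : M.EdgeClosed P) : M.EdgeClosed Pᶜ := fun h => not_congr (hP h)

theorem EdgeClosed.edge (h : H) : M.EdgeClosed {h, M.α h} := by
  intro g
  simp only [Set.mem_insert_iff, Set.mem_singleton_iff, M.α.injective.eq_iff]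
  constructor
  · rintro (h1 | h1)
    · right; rw [← h1, M.α_α]
    · left; exact h1
  · rintro (h1 | h1)
    · right; exact h1
    · left; rw [h1, M.α_α]

theorem EdgeClosed.union {Q : Set H} (hP : M.EdgeClosed P) (hQ : M.EdgeClosed Q) :
    M.EdgeClosed (P ∪ Q) := fun h => or_congr (hP h) (hQ h)

theorem EdgeClosed.diff {Q : Set H} (hP : M.EdgeClosed P) (hQ : M.EdgeClosed Q) :
    M.EdgeClosed (P \ Q) := hP.inter hQ.compl

theorem deleteEdge_eq_sub (h : H) : M.deleteEdge h = M.sub (Set.univ \ {h, M.α h}) := by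
  rw [deleteEdge, keep_eq_sub]
  congr 1
  ext g
  simp

variable (M) in
/-- Connectivity in the submap with the edges in `P`. -/
def Conn (P : Set H) : H → H → Prop := (M.sub P).SameComponent

theorem Conn.refl (x : H) : M.Conn P x x := SameComponent.refl _ x

theorem Conn.symm {x y : H} (h : M.Conn P x y) : M.Conn P y x := SameComponent.symm h

theorem Conn.trans {x y z : H} (h : M.Conn P x y) (h' : M.Conn P y z) : M.Conn P x z :=
  SameComponent.trans h h'

theorem SameVertex.conn {x y : H} (h : M.SameVertex x y) : M.Conn P x y :=
  SameVertex.sameComponent (M := M.sub P) h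

theorem conn_σ (x : H) : M.Conn P x (M.σ x) := sameComponent_σ (M.sub P) x

theorem conn_α (hP : M.EdgeClosed P) {x : H} (hx : x ∈ P) : M.Conn P x (M.α x) := by
  rw [← sub_α_of_mem hP hx]
  exact sameComponent_α _ x

theorem conn_induction [Finite H] (hP : M.EdgeClosed P) (I : H → Prop)
    (hσ : ∀ x, I x → I (M.σ x)) (hα : ∀ x ∈ P, I x → I (M.α x)) {x y : H} (h : M.Conn P x y)
    (hx : I x) : I y := by
  refine sameComponent_induction (M.sub P) I hσ (fun z hz => ?_) h hx
  by_cases hzP : z ∈ P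
  · rw [sub_α_of_mem hP hzP]; exact hα z hzP hz
  · rwa [sub_α_of_notMem hzP]

theorem Conn.mono [Finite H] {Q : Set H} (hP : M.EdgeClosed P) (hQ : M.EdgeClosed Q) (h : P ⊆ Q)
    {x y : H} (hxy : M.Conn P x y) : M.Conn Q x y :=
  conn_induction hP (fun z => M.Conn Q x z) (fun z hz => hz.trans (conn_σ z))
    (fun _ hz hxz => hxz.trans (conn_α hQ (h hz))) hxy (Conn.refl x)

theorem conn_empty_iff [Finite H] {x y : H} : M.Conn ∅ x y ↔ M.SameVertex x y :=
  ⟨fun h => conn_induction EdgeClosed.empty (M.SameVertex x)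
    (fun z hz => Equiv.Perm.SameCycle.trans hz (sameCycle_apply_self _ z))
    (fun _ hz => hz.elim) h (Equiv.Perm.SameCycle.refl _ _), SameVertex.conn⟩

variable (M) in
/-- Twice the sum of the genera of the components of the submap with the edges in `P`. -/
noncomputable def excess (P : Set H) : ℤ :=
  (M.sub P).numEdges + 2 * (M.sub P).numComponents - M.numVertices - (M.sub P).numFaces

theorem isPlanar_sub_iff : (M.sub P).IsPlanar ↔ M.excess P = 0 := by
  have : (M.sub P).numVertices = M.numVertices := rfl
  rw [IsPlanar, excess, this]
  omega

/-! ### Adding an edge -/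

section AddEdge

variable {h : H}

theorem union_edge_α [DecidableEq H] (hP : M.EdgeClosed P) (hh : h ∉ P) :
    (M.sub (P ∪ {h, M.α h})).α = (M.sub P).α * Equiv.swap h (M.α h) := by
  have hh' : M.α h ∉ P := fun h' => hh ((hP h).1 h')
  have hU := hP.union (EdgeClosed.edge h)
  ext g
  rcases mul_swap_cases (M.sub P).α h (M.α h) g with ⟨rfl, h1⟩ | ⟨rfl, h1⟩ | ⟨h1, h2, h3⟩
  · rw [h1, sub_α_of_notMem hh', sub_α_of_mem hU (by simp)]
  · rw [h1, sub_α_of_notMem hh, sub_α_of_mem hU (by simp), M.α_α]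
  · rw [h3]
    by_cases hg : g ∈ P
    · rw [sub_α_of_mem hP hg, sub_α_of_mem hU (Or.inl hg)]
    · rw [sub_α_of_notMem hg, sub_α_of_notMem (by simp [hg, h1, h2])]

variable [Finite H]

theorem conn_union_edge_iff (hP : M.EdgeClosed P) {x y : H} :
    M.Conn (P ∪ {h, M.α h}) x y ↔ M.Conn P x y ∨ (M.Conn P x h ∧ M.Conn P (M.α h) y) ∨
      (M.Conn P x (M.α h) ∧ M.Conn P h y) := by
  have hU := hP.union (EdgeClosed.edge h)
  have hmono : ∀ {x y}, M.Conn P x y → M.Conn (P ∪ {h, M.α h}) x y :=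
    fun h => h.mono hP hU Set.subset_union_left
  have he : M.Conn (P ∪ {h, M.α h}) h (M.α h) := conn_α hU (by simp)
  constructor
  · intro hxy
    refine conn_induction hU (fun y => M.Conn P x y ∨ (M.Conn P x h ∧ M.Conn P (M.α h) y) ∨
      (M.Conn P x (M.α h) ∧ M.Conn P h y)) ?_ ?_ hxy (Or.inl (Conn.refl x))
    · rintro z (h1 | ⟨h1, h2⟩ | ⟨h1, h2⟩)
      · exact Or.inl (h1.trans (conn_σ z))
      · exact Or.inr (Or.inl ⟨h1, h2.trans (conn_σ z)⟩)
      · exact Or.inr (Or.inr ⟨h1, h2.trans (conn_σ z)⟩)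
    · rintro z (hz | rfl | rfl)
      · have := conn_α hP hz
        rintro (h1 | ⟨h1, h2⟩ | ⟨h1, h2⟩)
        · exact Or.inl (h1.trans this)
        · exact Or.inr (Or.inl ⟨h1, h2.trans this⟩)
        · exact Or.inr (Or.inr ⟨h1, h2.trans this⟩)
      · rintro (h1 | ⟨h1, h2⟩ | ⟨h1, h2⟩)
        · exact Or.inr (Or.inl ⟨h1, Conn.refl _⟩)
        · exact Or.inr (Or.inl ⟨h1, Conn.refl _⟩)
        · exact Or.inl h1
      · rw [M.α_α]
        rintro (h1 | ⟨h1, h2⟩ | ⟨h1, h2⟩)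
        · exact Or.inr (Or.inr ⟨h1, Conn.refl _⟩)
        · exact Or.inl h1
        · exact Or.inr (Or.inr ⟨h1, Conn.refl _⟩)
  · rintro (h1 | ⟨h1, h2⟩ | ⟨h1, h2⟩)
    · exact hmono h1
    · exact (hmono h1).trans (he.trans (hmono h2))
    · exact (hmono h1).trans (he.symm.trans (hmono h2))

theorem numComponents_union_edge_of_conn (hP : M.EdgeClosed P) (hc : M.Conn P h (M.α h)) :
    (M.sub (P ∪ {h, M.α h})).numComponents = (M.sub P).numComponents := by
  rw [numComponents_eq, numComponents_eq]
  refine Nat.card_congr (Quotient.congr (Equiv.refl H) fun x y => ?_)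
  refine (conn_union_edge_iff hP).trans ⟨?_, Or.inl⟩
  rintro (h1 | ⟨h1, h2⟩ | ⟨h1, h2⟩)
  · exact h1
  · exact h1.trans (hc.trans h2)
  · exact h1.trans (hc.symm.trans h2)

theorem numComponents_union_edge_of_not_conn (hP : M.EdgeClosed P) (hc : ¬ M.Conn P h (M.α h)) :
    (M.sub P).numComponents = (M.sub (P ∪ {h, M.α h})).numComponents + 1 := by
  rw [numComponents_eq, numComponents_eq]
  exact card_quotient_glue _ _ h (M.α h) hc fun x y => conn_union_edge_iff hP

theorem numEdges_union_edge (hP : M.EdgeClosed P) (hh : h ∉ P) (hne : M.α h ≠ h) :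
    (M.sub (P ∪ {h, M.α h})).numEdges = (M.sub P).numEdges + 1 := by
  have hU := hP.union (EdgeClosed.edge h)
  have hset : {e : Set H | ∃ g, (M.sub (P ∪ {h, M.α h})).α g ≠ g ∧
      e = {g, (M.sub (P ∪ {h, M.α h})).α g}} = insert {h, M.α h}
      {e : Set H | ∃ g, (M.sub P).α g ≠ g ∧ e = {g, (M.sub P).α g}} := by
    ext e
    simp only [Set.mem_ofPred_eq, Set.mem_insert_iff]
    constructor
    · rintro ⟨g, h1, rfl⟩
      by_cases hg : g ∈ P
      · right
        rw [sub_α_of_mem hU (Or.inl hg)] at h1 ⊢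
        exact ⟨g, by rwa [sub_α_of_mem hP hg], by rw [sub_α_of_mem hP hg]⟩
      · left
        have hgU : g ∈ P ∪ {h, M.α h} := by
          by_contra hgU
          exact h1 (sub_α_of_notMem hgU)
        rw [sub_α_of_mem hU hgU]
        rcases hgU with hg' | rfl | rfl
        · exact (hg hg').elim
        · rfl
        · rw [M.α_α, Set.pair_comm]
    · rintro (rfl | ⟨g, h1, rfl⟩)
      · exact ⟨h, by rwa [sub_α_of_mem hU (by simp)], by rw [sub_α_of_mem hU (by simp)]⟩
      · have hg : g ∈ P := by
          by_contra hg
          exact h1 (sub_α_of_notMem hg)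
        rw [sub_α_of_mem hP hg] at h1 ⊢
        exact ⟨g, by rwa [sub_α_of_mem hU (Or.inl hg)], by rw [sub_α_of_mem hU (Or.inl hg)]⟩
  rw [numEdges, numEdges, hset, Set.ncard_insert_of_notMem]
  rintro ⟨g, h1, h2⟩
  have hg : g ∈ P := by
    by_contra hg
    exact h1 (sub_α_of_notMem hg)
  rw [sub_α_of_mem hP hg] at h2
  have : h ∈ ({g, M.α g} : Set H) := h2 ▸ Set.mem_insert _ _
  rcases this with rfl | rfl
  · exact hh hg
  · exact hh ((hP g).2 hg)

/-- The face permutation is multiplied by the transposition of the two ends. A face containing both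
ends is split, which requires them to be connected already; otherwise two faces merge. -/
theorem numFaces_union_edge (hP : M.EdgeClosed P) (hh : h ∉ P) (hne : M.α h ≠ h) :
    (M.sub (P ∪ {h, M.α h})).numFaces = (M.sub P).numFaces + 1 ∧ M.Conn P h (M.α h) ∨
      (M.sub P).numFaces = (M.sub (P ∪ {h, M.α h})).numFaces + 1 := by
  classical
  have h1 : (M.sub (P ∪ {h, M.α h})).σ * (M.sub (P ∪ {h, M.α h})).α =
      ((M.sub P).σ * (M.sub P).α) * Equiv.swap h (M.α h) := by
    rw [union_edge_α hP hh, mul_assoc]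
    rfl
  rw [numFaces, numFaces, h1]
  by_cases hs : ((M.sub P).σ * (M.sub P).α).SameCycle h (M.α h)
  · left
    refine ⟨card_cycles_mul_swap_of_sameCycle _ hne.symm hs, ?_⟩
    refine sameCycle_induction _ (M.Conn P h) (fun x hx => hx.trans ?_) hs (Conn.refl h)
    exact (sameComponent_α (M.sub P) x).trans (sameComponent_σ (M.sub P) _)
  · right
    exact card_cycles_mul_swap_of_not_sameCycle _ hs

/-- One more edge, one component less, one face less: the changes `1 - 2 + 1` cancel. -/
theorem excess_union_edge_of_not_conn (hP : M.EdgeClosed P) (hne : M.α h ≠ h)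
    (hc : ¬ M.Conn P h (M.α h)) : M.excess (P ∪ {h, M.α h}) = M.excess P := by
  have hh : h ∉ P := fun hh => hc (conn_α hP hh)
  have h1 := numComponents_union_edge_of_not_conn hP hc
  have h2 := numEdges_union_edge hP hh hne
  have h3 := numFaces_union_edge hP hh hne
  simp only [hc, and_false, false_or] at h3
  simp only [excess]
  omega

/-- An edge that closes a cycle changes `E` by `1` and `F` by `±1` with `K` fixed, so the excess
grows by `0` or `2`. -/
theorem excess_le_union_edge (hP : M.EdgeClosed P) (hh : h ∉ P) (hne : M.α h ≠ h) :
    M.excess P ≤ M.excess (P ∪ {h, M.α h}) := by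
  by_cases hc : M.Conn P h (M.α h)
  · have h1 := numComponents_union_edge_of_conn hP hc
    have h2 := numEdges_union_edge hP hh hne
    have h3 := numFaces_union_edge hP hh hne
    simp only [excess]
    omega
  · exact (excess_union_edge_of_not_conn hP hne hc).ge

end AddEdge

/-! ### Monotonicity of the genus -/

/-- Induction that adds the edges of `Q` to those of `P` one by one. -/
theorem edge_induction [Finite H] (T : Set H → Prop) {P Q : Set H} (hP : M.EdgeClosed P)
    (hQ : M.EdgeClosed Q) (hPQ : P ⊆ Q) (h0 : T P)
    (step : ∀ R, M.EdgeClosed R → P ⊆ R → ∀ h ∈ Q, h ∉ R → R ∪ {h, M.α h} ⊆ Q → T R →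
      T (R ∪ {h, M.α h})) : T Q := by
  have key : ∀ n, ∀ R, M.EdgeClosed R → P ⊆ R → R ⊆ Q → T R → (Q \ R).ncard = n → T Q := by
    intro n
    induction n using Nat.strong_induction_on with
    | _ n ih =>
      intro R hR hPR hRQ hT hn
      by_cases he : Q ⊆ R
      · rwa [hRQ.antisymm he] at hT
      · obtain ⟨h, hhQ, hhR⟩ := Set.not_subset.1 he
        have hsub : R ∪ {h, M.α h} ⊆ Q := by
          rintro x (hx | rfl | rfl)
          · exact hRQ hx
          · exact hhQ
          · exact (hQ h).2 hhQ
        refine ih _ ?_ _ (hR.union (EdgeClosed.edge h)) (hPR.trans Set.subset_union_left) hsub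
          (step R hR hPR h hhQ hhR hsub hT) rfl
        rw [← hn]
        refine Set.ncard_lt_ncard ?_ (Set.toFinite _)
        refine ⟨Set.sdiff_subset_sdiff_right Set.subset_union_left, fun h' => ?_⟩
        exact (h' ⟨hhQ, hhR⟩).2 (by simp)
  exact key _ P hP le_rfl hPQ h0 rfl

theorem numEdges_empty : (M.sub ∅).numEdges = 0 := by
  have h0 : (M.sub ∅).α = 1 := Equiv.ext fun h => sub_α_of_notMem (by simp)
  rw [numEdges, h0]
  simp

theorem numComponents_empty [Finite H] : (M.sub ∅).numComponents = M.numVertices := by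
  rw [numComponents_eq]
  exact Nat.card_congr (Quotient.congr (Equiv.refl H) fun x y => conn_empty_iff)

theorem excess_empty [Finite H] : M.excess ∅ = 0 := by
  have h0 : (M.sub ∅).α = 1 := Equiv.ext fun h => sub_α_of_notMem (by simp)
  have h2 : (M.sub ∅).numFaces = M.numVertices := by
    rw [numFaces, h0, mul_one]
    rfl
  rw [excess, numEdges_empty, h2, numComponents_empty]
  push_cast
  ring

theorem excess_mono [Finite H] (hα : ∀ h, M.α h ≠ h) {P Q : Set H} (hP : M.EdgeClosed P)
    (hQ : M.EdgeClosed Q) (hPQ : P ⊆ Q) : M.excess P ≤ M.excess Q :=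
  edge_induction (fun R => M.excess P ≤ M.excess R) hP hQ hPQ le_rfl
    fun _ hR _ h _ hhR _ hT => hT.trans (excess_le_union_edge hR hhR (hα h))

theorem excess_nonneg [Finite H] (hα : ∀ h, M.α h ≠ h) (hP : M.EdgeClosed P) : 0 ≤ M.excess P :=
  excess_empty.symm.le.trans (excess_mono hα EdgeClosed.empty hP (Set.empty_subset P))

theorem two_mul_numEdges [Finite H] (hα : ∀ h, M.α h ≠ h) (hP : M.EdgeClosed P) :
    2 * (M.sub P).numEdges = P.ncard := by
  refine edge_induction (fun R => 2 * (M.sub R).numEdges = R.ncard) EdgeClosed.empty hP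
    (Set.empty_subset P) (by simp [numEdges_empty]) fun R hR _ h _ hhR _ hT => ?_
  have hd : Disjoint R {h, M.α h} := by
    rw [Set.disjoint_right]
    rintro x (rfl | rfl)
    · exact hhR
    · exact fun h' => hhR ((hR h).1 h')
  rw [numEdges_union_edge hR hhR (hα h), Set.ncard_union_eq hd, Set.ncard_pair (hα h).symm, ← hT]
  ring

variable {H : Type*} {M : CombMap H} {P : Set H}

open Classical in
-- Up to the constant number of vertices, `E + K` is the cycle rank: it grows exactly when the new
-- edge closes a cycle.
theorem numEdges_add_numComponents_union_edge [Finite H] {h : H} (hP : M.EdgeClosed P)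
    (hh : h ∉ P) (hne : M.α h ≠ h) :
    (M.sub (P ∪ {h, M.α h})).numEdges + (M.sub (P ∪ {h, M.α h})).numComponents =
      (M.sub P).numEdges + (M.sub P).numComponents + if M.Conn P h (M.α h) then 1 else 0 := by
  rw [numEdges_union_edge hP hh hne]
  by_cases hc : M.Conn P h (M.α h)
  · rw [numComponents_union_edge_of_conn hP hc, if_pos hc]
    ring
  · rw [numComponents_union_edge_of_not_conn hP hc, if_neg hc]
    ring

theorem isBridge_iff {h : H} : M.IsBridge h ↔ ¬ M.Conn (Set.univ \ {h, M.α h}) h (M.α h) := by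
  rw [IsBridge, deleteEdge_eq_sub]
  rfl

theorem IsBridge.not_conn [Finite H] {h : H} (hb : M.IsBridge h) (hP : M.EdgeClosed P)
    (hh : h ∉ P) : ¬ M.Conn P h (M.α h) := by
  intro hc
  refine isBridge_iff.1 hb (hc.mono hP (EdgeClosed.univ.diff (EdgeClosed.edge h)) ?_)
  rintro x hx
  refine ⟨trivial, ?_⟩
  rintro (rfl | rfl)
  · exact hh hx
  · exact hh ((hP h).1 hx)

/-- The genus is not changed by the addition of bridges. -/
theorem excess_eq_of_bridges [Finite H] (hα : ∀ h, M.α h ≠ h) {Q : Set H} (hP : M.EdgeClosed P)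
    (hQ : M.EdgeClosed Q) (hPQ : P ⊆ Q) (hb : ∀ h ∈ Q, h ∉ P → M.IsBridge h) :
    M.excess Q = M.excess P := by
  refine edge_induction (fun R => M.excess R = M.excess P) hP hQ hPQ rfl ?_
  intro R hR hPR h hhQ hhR _ hT
  rw [← hT]
  exact excess_union_edge_of_not_conn hR (hα h) ((hb h hhQ fun h' => hhR (hPR h')).not_conn hR hhR)

end CombMap

/-! ### The defect -/

namespace DecoratedMap

open CombMap

variable {d : ℕ} {H : Type*} (M : DecoratedMap d H)

/-- The half-edges of the edges whose colour set contains `c`. -/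
def withColor (c : Fin d) : Set H := {h | c ∈ (M.color h).1}

/-- The half-edges of the edges with colour set `C`. -/
def colored (C : ColorSet d) : Set H := {h | M.color h = C}

theorem edgeClosed_withColor (c : Fin d) : M.EdgeClosed (M.withColor c) := fun h => by
  change c ∈ (M.color (M.α h)).1 ↔ c ∈ (M.color h).1
  rw [M.color_α]

theorem edgeClosed_colored (C : ColorSet d) : M.EdgeClosed (M.colored C) := fun h => by
  change M.color (M.α h) = C ↔ M.color h = C
  rw [M.color_α]

theorem colorSubmap_eq_sub (C : ColorSet d) : M.colorSubmap C = M.sub (M.colored C) :=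
  keep_eq_sub _ _ _

variable {M} {P : Set H} {h : H}

theorem union_edge_inter_withColor_of_mem {c : Fin d} (hc : c ∈ (M.color h).1) :
    (P ∪ {h, M.α h}) ∩ M.withColor c = (P ∩ M.withColor c) ∪ {h, M.α h} := by
  have he : ({h, M.α h} : Set H) ⊆ M.withColor c := by
    rintro x (rfl | rfl)
    · exact hc
    · exact (edgeClosed_withColor M c h).2 hc
  rw [Set.union_inter_distrib_right, Set.inter_eq_left.2 he]

theorem union_edge_inter_withColor_of_notMem {c : Fin d} (hc : c ∉ (M.color h).1) :
    (P ∪ {h, M.α h}) ∩ M.withColor c = P ∩ M.withColor c := by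
  rw [Set.union_inter_distrib_right, Set.union_eq_left]
  rintro x ⟨rfl | rfl, hx⟩
  · exact (hc hx).elim
  · exact (hc ((edgeClosed_withColor M c h).1 hx)).elim

variable (M) in
/-- The contribution to `d - δ` (for the scaling `s C = |C| - d`) of the cycles of the submap with
the edges in `P`. -/
noncomputable def defect (P : Set H) : ℤ :=
  d * (M.numVertices + (M.sub P).numEdges + (M.sub P).numComponents) -
    2 * ∑ c, ((M.sub (P ∩ M.withColor c)).numEdges + (M.sub (P ∩ M.withColor c)).numComponents : ℤ)

theorem defect_empty [Finite H] : M.defect ∅ = 0 := by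
  simp only [defect, Set.empty_inter, numEdges_empty, numComponents_empty, Finset.sum_const,
    Finset.card_univ, Fintype.card_fin]
  push_cast
  simp only [nsmul_eq_mul]
  ring

open Classical in
-- As all submaps share their vertices, the defect is `d` times the cycle rank of `P` minus twice
-- the cycle ranks of its colour submaps. A colour outside the set of the new edge leaves its submap
-- unchanged.
theorem defect_union_edge [Finite H] (hP : M.EdgeClosed P) (hh : h ∉ P) :
    M.defect (P ∪ {h, M.α h}) = M.defect P + (if M.Conn P h (M.α h) then (d : ℤ) else 0) -
      2 * ((M.color h).1.filter fun c => M.Conn (P ∩ M.withColor c) h (M.α h)).card := by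
  have h1 := numEdges_add_numComponents_union_edge hP hh (M.α_ne h)
  have h2 : ∀ c : Fin d, ((M.sub ((P ∪ {h, M.α h}) ∩ M.withColor c)).numEdges +
      (M.sub ((P ∪ {h, M.α h}) ∩ M.withColor c)).numComponents : ℤ) =
      ((M.sub (P ∩ M.withColor c)).numEdges + (M.sub (P ∩ M.withColor c)).numComponents : ℤ) +
      if c ∈ (M.color h).1.filter fun c => M.Conn (P ∩ M.withColor c) h (M.α h)
        then 1 else 0 := by
    intro c
    by_cases hc : c ∈ (M.color h).1
    · rw [union_edge_inter_withColor_of_mem hc]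
      have := numEdges_add_numComponents_union_edge (hP.inter (edgeClosed_withColor M c))
        (fun h' => hh h'.1) (M.α_ne h)
      simp only [Finset.mem_filter, hc, true_and]
      exact_mod_cast this
    · rw [union_edge_inter_withColor_of_notMem hc]
      simp [hc]
  have h1' : ((M.sub (P ∪ {h, M.α h})).numEdges : ℤ) + (M.sub (P ∪ {h, M.α h})).numComponents =
      (M.sub P).numEdges + (M.sub P).numComponents + if M.Conn P h (M.α h) then 1 else 0 := by
    exact_mod_cast h1
  rw [defect, defect, Finset.sum_congr rfl fun c _ => h2 c, Finset.sum_add_distrib,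
    add_assoc (M.numVertices : ℤ), h1', Finset.sum_ite_mem, Finset.univ_inter]
  simp only [Finset.sum_const]
  split_ifs <;> simp <;> ring

theorem defect_union_edge_of_not_conn [Finite H] (hP : M.EdgeClosed P)
    (hc : ¬ M.Conn P h (M.α h)) : M.defect (P ∪ {h, M.α h}) = M.defect P := by
  classical
  rw [defect_union_edge hP fun hh => hc (conn_α hP hh), if_neg hc, Finset.filter_false_of_mem]
  · simp
  · intro c _ h'
    exact hc (h'.mono (hP.inter (edgeClosed_withColor M c)) hP Set.inter_subset_left)

theorem defect_le_union_edge [Finite H] (hP : M.EdgeClosed P) (hh : h ∉ P) :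
    M.defect P ≤ M.defect (P ∪ {h, M.α h}) := by
  classical
  by_cases hc : M.Conn P h (M.α h)
  · rw [defect_union_edge hP hh, if_pos hc]
    have h1 := Finset.card_filter_le (M.color h).1
      fun c => M.Conn (P ∩ M.withColor c) h (M.α h)
    have h2 := (M.color h).2.2.1
    omega
  · exact (defect_union_edge_of_not_conn hP hc).ge

/-- An edge that is not a bridge and does not raise the defect has `d / 2` colours, and its ends are
connected by the edges that contain any of its colours. -/
theorem conn_withColor_of_defect_eq [Finite H] (hP : M.EdgeClosed P) (hh : h ∉ P)
    (hd : M.defect (P ∪ {h, M.α h}) = M.defect P) (hc : M.Conn P h (M.α h)) :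
    2 * (M.color h).1.card = d ∧
      ∀ c ∈ (M.color h).1, M.Conn (P ∩ M.withColor c) h (M.α h) := by
  classical
  rw [defect_union_edge hP hh, if_pos hc] at hd
  have h1 := Finset.card_filter_le (M.color h).1
    fun c => M.Conn (P ∩ M.withColor c) h (M.α h)
  have h2 := (M.color h).2.2.1
  have h3 : ((M.color h).1.filter fun c => M.Conn (P ∩ M.withColor c) h (M.α h)).card =
    (M.color h).1.card := by omega
  exact ⟨by omega, Finset.card_filter_eq_iff.1 h3⟩

/-- A path through edges of the same colour set serves all its colours at once, so the regained
amount is `2|C| = d`. -/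
theorem defect_union_edge_of_conn_colored [Finite H] (hP : M.EdgeClosed P) (hh : h ∉ P)
    (h2 : 2 * (M.color h).1.card = d) (hC : M.Conn (P ∩ M.colored (M.color h)) h (M.α h)) :
    M.defect (P ∪ {h, M.α h}) = M.defect P := by
  classical
  have hc : M.Conn P h (M.α h) :=
    hC.mono (hP.inter (edgeClosed_colored M _)) hP Set.inter_subset_left
  rw [defect_union_edge hP hh, if_pos hc, Finset.filter_true_of_mem]
  · omega
  · intro c hcC
    refine hC.mono (hP.inter (edgeClosed_colored M _)) (hP.inter (edgeClosed_withColor M c)) ?_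
    rintro x ⟨hx, hx'⟩
    refine ⟨hx, ?_⟩
    change c ∈ (M.color x).1
    rwa [show M.color x = M.color h from hx']

theorem defect_mono [Finite H] {Q : Set H} (hP : M.EdgeClosed P) (hQ : M.EdgeClosed Q)
    (hPQ : P ⊆ Q) : M.defect P ≤ M.defect Q :=
  edge_induction (fun R => M.defect P ≤ M.defect R) hP hQ hPQ le_rfl
    fun _ hR _ _ _ hhR _ hT => hT.trans (defect_le_union_edge hR hhR)

theorem defect_nonneg [Finite H] (hP : M.EdgeClosed P) : 0 ≤ M.defect P :=
  defect_empty.symm.le.trans (defect_mono EdgeClosed.empty hP (Set.empty_subset P))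

/-- This allows the edges to be added in any order, each step leaving the defect at zero. -/
theorem defect_eq_zero_of_univ [Finite H] (h0 : M.defect Set.univ = 0) (hP : M.EdgeClosed P) :
    M.defect P = 0 :=
  le_antisymm ((defect_mono hP EdgeClosed.univ (Set.subset_univ P)).trans h0.le) (defect_nonneg hP)

/-! ### Cut-vertices -/

/-- Two colour sets of which the first has a colour that is not in the second meet only at
cut-vertices, if the defect vanishes. -/
theorem separatedByCutVertex_of_mem_of_notMem [Finite H] (h0 : M.defect Set.univ = 0) {h' : H}
    (hv : M.SameVertex h h') {c : Fin d} (hc : c ∈ (M.color h).1) (hc' : c ∉ (M.color h').1) :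
    M.SeparatedByCutVertex h h' := by
  -- the edges that avoid the vertex
  set P : Set H := {g | ¬ M.SameVertex h g ∧ ¬ M.SameVertex h (M.α g)} with hPdef
  have hP : M.EdgeClosed P := by
    intro g
    change ¬ M.SameVertex h (M.α g) ∧ ¬ M.SameVertex h (M.α (M.α g)) ↔
      ¬ M.SameVertex h g ∧ ¬ M.SameVertex h (M.α g)
    rw [M.α_α, and_comm]
  have hσ : ∀ g, M.SameVertex h g ↔ M.SameVertex h (M.σ g) := fun g =>
    Equiv.Perm.sameCycle_apply_right.symm
  -- Let `f` leave the vertex with colour `c` and reach, away from the vertex, an edge `g` that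
  -- returns to it. Were `c` not a colour of `g`, zero defect would still link the ends of `f`
  -- through `c`-edges of `P ∪ {g, α g}`; none of these touches the vertex, so the path could never
  -- leave it.
  have key : ∀ f g, M.SameVertex h f → c ∈ (M.color f).1 → ¬ M.SameVertex h (M.α f) →
      M.SameVertex h (M.α g) → ¬ M.SameVertex h g → M.Conn P (M.α f) g → c ∈ (M.color g).1 := by
    intro f g hf hcf hf' hg hg' hfg
    by_contra hcg
    have hPg := hP.union (EdgeClosed.edge g)
    have hfP : f ∉ P ∪ {g, M.α g} := by
      rintro (hfP | rfl | rfl)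
      · exact hfP.1 hf
      · exact hcg hcf
      · exact hcg (by rwa [M.color_α] at hcf)
    have hcon : M.Conn (P ∪ {g, M.α g}) f (M.α f) := by
      have h1 : M.Conn (P ∪ {g, M.α g}) (M.α f) g := hfg.mono hP hPg Set.subset_union_left
      have h2 : M.Conn (P ∪ {g, M.α g}) g (M.α g) := conn_α hPg (by simp)
      have h3 : M.Conn (P ∪ {g, M.α g}) (M.α g) f :=
        SameVertex.conn (Equiv.Perm.SameCycle.trans (Equiv.Perm.SameCycle.symm hg) hf)
      exact (h1.trans (h2.trans h3)).symm
    have h4 := (conn_withColor_of_defect_eq hPg hfP ((defect_eq_zero_of_univ h0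
      (hPg.union (EdgeClosed.edge f))).trans (defect_eq_zero_of_univ h0 hPg).symm) hcon).2 c hcf
    refine hf' (conn_induction (hPg.inter (edgeClosed_withColor M c)) (M.SameVertex h)
      (fun x hx => (hσ x).1 hx) ?_ h4 hf)
    rintro x ⟨hx | hx | hx, hxc⟩ hxh
    · exact (hx.1 hxh).elim
    · exact (hcg (hx ▸ hxc)).elim
    · rw [hx] at hxc
      exact (hcg ((edgeClosed_withColor M c g).1 hxc)).elim
  -- The class of `h`: the half-edges with colour `c` at the vertex, and everything that their edges
  -- reach once the vertex is removed. By `key` it is closed under `α`.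
  let S : Set H := {g | (M.SameVertex h g ∧ c ∈ (M.color g).1) ∨ (¬ M.SameVertex h g ∧
    ∃ f, M.SameVertex h f ∧ c ∈ (M.color f).1 ∧ ¬ M.SameVertex h (M.α f) ∧
      M.Conn P (M.α f) g)}
  have hS : ∀ g ∈ S, M.α g ∈ S := by
    rintro g (⟨h1, h2⟩ | ⟨h1, f, h2, h3, h4, h5⟩)
    · by_cases h3 : M.SameVertex h (M.α g)
      · exact Or.inl ⟨h3, by rwa [M.color_α]⟩
      · exact Or.inr ⟨h3, g, h1, h2, h3, Conn.refl _⟩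
    · by_cases h6 : M.SameVertex h (M.α g)
      · refine Or.inl ⟨h6, ?_⟩
        rw [M.color_α]
        exact key f g h2 h3 h4 h6 h1 h5
      · exact Or.inr ⟨h6, f, h2, h3, h4, h5.trans (conn_α hP ⟨h1, h6⟩)⟩
  refine ⟨hv, S, fun g => ⟨fun hg => ?_, hS g⟩, Or.inl ⟨Equiv.Perm.SameCycle.refl _ _, hc⟩, ?_, ?_⟩
  · have := hS _ hg
    rwa [M.α_α] at this
  · rintro (⟨_, h1⟩ | ⟨h1, _⟩)
    · exact hc' h1
    · exact h1 hv
  · rintro g (⟨h1, _⟩ | ⟨h1, f, h2, h3, h4, h5⟩) g' hg' hgg'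
    · exact h1
    · refine (hg' (Or.inr ⟨fun h6 => h1 ?_, f, h2, h3, h4, h5.trans hgg'.conn⟩)).elim
      exact Equiv.Perm.SameCycle.trans h6 (Equiv.Perm.SameCycle.symm hgg')

theorem _root_.QuarticTensor.CombMap.SeparatedByCutVertex.symm {N : CombMap H} {h h' : H}
    (hs : N.SeparatedByCutVertex h h') : N.SeparatedByCutVertex h' h := by
  obtain ⟨hv, S, h1, h2, h3, h4⟩ := hs
  refine ⟨Equiv.Perm.SameCycle.symm hv, Sᶜ, fun g => not_congr (h1 g), h3, fun h => h h2, ?_⟩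
  intro g hg g' hg' hgg'
  have h5 := h4 g' (not_not.1 hg') g hg (Equiv.Perm.SameCycle.symm hgg')
  exact Equiv.Perm.SameCycle.trans (Equiv.Perm.SameCycle.symm hv)
    (Equiv.Perm.SameCycle.trans h5 (Equiv.Perm.SameCycle.symm hgg'))

theorem meetOnlyAtCutVertices_of_defect_eq_zero [Finite H] (h0 : M.defect Set.univ = 0)
    {C C' : ColorSet d} (hC : C ≠ C') : M.MeetOnlyAtCutVertices C C' := by
  rintro h h' rfl rfl hv
  by_cases h1 : (M.color h).1 ⊆ (M.color h').1
  · have h2 : ¬ (M.color h').1 ⊆ (M.color h).1 := fun h2 => hC (Subtype.ext (h1.antisymm h2))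
    obtain ⟨c, hc, hc'⟩ := Finset.not_subset.1 h2
    exact (separatedByCutVertex_of_mem_of_notMem h0 (Equiv.Perm.SameCycle.symm hv) hc hc').symm
  · obtain ⟨c, hc, hc'⟩ := Finset.not_subset.1 h1
    exact separatedByCutVertex_of_mem_of_notMem h0 hv hc hc'

/-- A connection between two half-edges on one side of a cut-vertex can be made on that side. -/
theorem _root_.QuarticTensor.CombMap.Conn.inter_of_cutVertex [Finite H] {N : CombMap H}
    {P S : Set H} (hP : N.EdgeClosed P) (hS : N.EdgeClosed S) {g : H}
    (hcut : ∀ x ∈ S, ∀ y ∉ S, N.SameVertex x y → N.SameVertex g x) {a b : H} (ha : a ∈ S)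
    (hb : b ∈ S) (hab : N.Conn P a b) : N.Conn (P ∩ S) a b := by
  have hPS := hP.inter hS
  let T : H → Prop := fun x => ∃ s ∈ S, N.SameVertex s x
  have hT : ∀ x ∈ S, T x := fun x hx => ⟨x, hx, Equiv.Perm.SameCycle.refl _ _⟩
  -- A path can leave and re-enter `S` only at the vertex of `g`. At vertices touched by `S` the
  -- invariant records a connection inside `S`; elsewhere it remembers that the vertex of `g` was
  -- reached inside `S`.
  let I : H → Prop := fun x => (T x → N.Conn (P ∩ S) a x) ∧ (¬ T x → N.Conn (P ∩ S) a g)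
  have hTσ : ∀ x, T (N.σ x) ↔ T x := fun x =>
    exists_congr fun s => and_congr_right fun _ => Equiv.Perm.sameCycle_apply_right
  have hg : ∀ x, x ∉ S → I x → N.Conn (P ∩ S) a g := by
    intro x hx hI
    by_cases hTx : T x
    · obtain ⟨s, hs, hsx⟩ := hTx
      exact (hI.1 ⟨s, hs, hsx⟩).trans
        (SameVertex.conn (Equiv.Perm.SameCycle.trans (hcut s hs x hx hsx) hsx)).symm
    · exact hI.2 hTx
  have hIb : I b := by
    refine conn_induction hP I ?_ ?_ hab ⟨fun _ => Conn.refl a, fun h => (h (hT a ha)).elim⟩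
    · intro x hx
      exact ⟨fun h => (hx.1 ((hTσ x).1 h)).trans (conn_σ x), fun h => hx.2 fun h' => h ((hTσ x).2 h')⟩
    · intro x hxP hx
      by_cases hxS : x ∈ S
      · exact ⟨fun _ => (hx.1 (hT x hxS)).trans (conn_α hPS ⟨hxP, hxS⟩),
          fun h => (h (hT _ ((hS x).2 hxS))).elim⟩
      · have h1 := hg x hxS hx
        have hxS' : N.α x ∉ S := fun h => hxS ((hS x).1 h)
        refine ⟨?_, fun _ => h1⟩
        rintro ⟨s, hs, hsx⟩
        exact h1.trans (SameVertex.conn (Equiv.Perm.SameCycle.trans (hcut s hs _ hxS' hsx) hsx))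
  exact hIb.1 (hT b hb)

/-- If different colour sets meet only at cut-vertices, then the ends of an edge that are connected
are connected by edges with the colour set of that edge. -/
theorem conn_colored_of_meetOnlyAtCutVertices [Finite H]
    (hM : ∀ C C', C ≠ C' → M.MeetOnlyAtCutVertices C C') (hP : M.EdgeClosed P)
    (hc : M.Conn P h (M.α h)) : M.Conn (P ∩ M.colored (M.color h)) h (M.α h) := by
  -- Together with the edge of `h`, a minimal connecting set of edges plays the role of a cycle.
  obtain ⟨Q, ⟨⟨hQ, hQP⟩, hQc⟩, hmin⟩ := Set.Finite.exists_minimal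
    (s := {Q : Set H | (M.EdgeClosed Q ∧ Q ⊆ P) ∧ M.Conn Q h (M.α h)}) (Set.toFinite _)
    ⟨P, ⟨hP, le_rfl⟩, hc⟩
  have hcol := edgeClosed_colored M (M.color h)
  have hQC := hQ.inter hcol
  have hX := hQ.union (EdgeClosed.edge (M := M.toCombMap) h)
  set X : Set H := Q ∪ {h, M.α h}
  -- The cycle lies on one side of every cut-vertex: its part on the side of `h` already connects
  -- the ends, so minimality excludes the rest.
  have hXS : ∀ S, M.EdgeClosed S → h ∈ S → ∀ g, (∀ x ∈ S, ∀ y ∉ S, M.SameVertex x y →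
      M.SameVertex g x) → X ⊆ S := by
    intro S hS hhS g hcut
    have h1 := Conn.inter_of_cutVertex hQ hS hcut hhS ((hS h).2 hhS) hQc
    have h2 := hmin (y := Q ∩ S) ⟨⟨hQ.inter hS, Set.inter_subset_left.trans hQP⟩, h1⟩
      Set.inter_subset_left
    rintro x (hx | rfl | rfl)
    · exact (h2 hx).2
    · exact hhS
    · exact (hS h).2 hhS
  -- Two edges of the cycle with different colour sets at a common vertex would be on opposite sides
  -- of a cut-vertex.
  have hmono : ∀ g ∈ X, ∀ g' ∈ X, M.SameVertex g g' → M.color g = M.color h →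
      M.color g' = M.color h := by
    intro g hg g' hg' hv hgC
    by_contra hne
    obtain ⟨-, S, hS, h1, h2, h3⟩ := hM _ _ (fun e => hne (e.symm.trans hgC)) g g' rfl rfl hv
    by_cases hhS : h ∈ S
    · exact h2 (hXS S hS hhS g h3 hg')
    · refine hXS Sᶜ (EdgeClosed.compl hS) hhS g ?_ hg h1
      intro x hx y hy hxy
      exact Equiv.Perm.SameCycle.trans (h3 y (not_not.1 hy) x hx (Equiv.Perm.SameCycle.symm hxy))
        (Equiv.Perm.SameCycle.symm hxy)
  -- Walking along `Q` from `h`, the colour set is passed on from vertex to vertex.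
  have key : M.Conn (Q ∩ M.colored (M.color h)) h (M.α h) := by
    refine (conn_induction hQ (fun x => (∃ g ∈ X, M.color g = M.color h ∧ M.SameVertex g x) ∧
      M.Conn (Q ∩ M.colored (M.color h)) h x) ?_ ?_ hQc
      ⟨⟨h, Or.inr (by simp), rfl, Equiv.Perm.SameCycle.refl _ _⟩, Conn.refl h⟩).2
    · rintro x ⟨⟨g, h1, h2, h3⟩, h4⟩
      exact ⟨⟨g, h1, h2, Equiv.Perm.sameCycle_apply_right.2 h3⟩, h4.trans (conn_σ x)⟩
    · rintro x hx ⟨⟨g, h1, h2, h3⟩, h4⟩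
      have h5 := hmono g h1 x (Or.inl hx) h3 h2
      refine ⟨⟨M.α x, (hX x).2 (Or.inl hx), (M.color_α x).trans h5, Equiv.Perm.SameCycle.refl _ _⟩,
        h4.trans (conn_α hQC ⟨hx, h5⟩)⟩
  exact key.mono hQC (hP.inter hcol) (Set.inter_subset_inter_left _ hQP)

/-! ### The maps of the leading order -/

variable (M) in
/-- The number of bicoloured cycles. -/
noncomputable def totalFaces : ℕ := ∑ c, (M.sub (M.withColor c)).numFaces

theorem totalFaces_eq (M : DecoratedMap d H) : (M.totalFaces : ℤ) =
    d * M.numComponents + d * M.numEdges - ∑ c, ((M.sub (M.withColor c)).numEdges : ℤ) -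
      M.defect Set.univ - ∑ c, M.excess (M.withColor c) := by
  simp only [totalFaces, defect, excess, Set.univ_inter, sub_univ, Finset.sum_sub_distrib,
    Finset.sum_add_distrib, ← Finset.mul_sum, Finset.sum_const, Finset.card_univ, Fintype.card_fin,
    nsmul_eq_mul]
  push_cast
  ring

/-- Bridges and cut-vertices account for the defect, planarity for the excess. Genus passes to
submaps by monotonicity, and from the submap of a suitable colour back to the whole map because only
bridges are missing there. -/
theorem leading_iff [Finite H] (hd : 0 < d) :
    (M.defect Set.univ = 0 ∧ ∀ c, M.excess (M.withColor c) = 0) ↔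
      M.IsPlanar ∧ (∀ h : H, 2 * (M.color h).1.card < d → M.IsBridge h) ∧
      (∀ C : ColorSet d, (M.colorSubmap C).IsPlanar) ∧
      (∀ C C' : ColorSet d, C ≠ C' → M.MeetOnlyAtCutVertices C C') := by
  have hpl : M.IsPlanar ↔ M.excess Set.univ = 0 := by
    rw [← isPlanar_sub_iff, sub_univ]
  constructor
  · rintro ⟨h0, hg⟩
    have hb : ∀ h : H, 2 * (M.color h).1.card < d → M.IsBridge h := by
      intro h hh
      rw [isBridge_iff]
      intro hc
      have hP : M.EdgeClosed (Set.univ \ {h, M.α h}) := EdgeClosed.univ.diff (EdgeClosed.edge h)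
      have := conn_withColor_of_defect_eq hP (by simp) ((defect_eq_zero_of_univ h0
        (hP.union (EdgeClosed.edge h))).trans (defect_eq_zero_of_univ h0 hP).symm) hc
      omega
    have huniv : M.excess Set.univ = 0 := by
      -- The colour of value `0` lies in every admissible set with `d / 2` elements, so each edge
      -- without it has fewer colours and is a bridge.
      rw [← hg ⟨0, hd⟩]
      refine excess_eq_of_bridges M.α_ne (edgeClosed_withColor M _) EdgeClosed.univ
        (Set.subset_univ _) fun h _ hh => hb h (lt_of_le_of_ne (M.color h).2.2.1 fun e => hh ?_)
      obtain ⟨c, hc, h0⟩ := (M.color h).2.2.2 e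
      change _ ∈ (M.color h).1
      rwa [show (⟨0, hd⟩ : Fin d) = c from Fin.ext h0.symm]
    refine ⟨hpl.2 huniv, hb, fun C => ?_, fun C C' => meetOnlyAtCutVertices_of_defect_eq_zero h0⟩
    rw [colorSubmap_eq_sub, isPlanar_sub_iff]
    exact le_antisymm ((excess_mono M.α_ne (edgeClosed_colored M C) EdgeClosed.univ
      (Set.subset_univ _)).trans huniv.le) (excess_nonneg M.α_ne (edgeClosed_colored M C))
  · rintro ⟨hp, hb, -, hcut⟩
    refine ⟨?_, fun c => ?_⟩
    · refine edge_induction (M := M.toCombMap) (fun R => M.defect R = 0) EdgeClosed.empty EdgeClosed.univ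
        (Set.empty_subset _) defect_empty ?_
      intro R hR _ h _ hhR _ hT
      rw [← hT]
      by_cases hc : M.Conn R h (M.α h)
      -- An edge that closes a cycle is not a bridge, hence has `d / 2` colours.
      · refine defect_union_edge_of_conn_colored hR hhR (le_antisymm (M.color h).2.2.1 ?_)
          (conn_colored_of_meetOnlyAtCutVertices hcut hR hc)
        exact not_lt.1 fun hlt => (hb h hlt).not_conn hR hhR hc
      · exact defect_union_edge_of_not_conn hR hc
    · exact le_antisymm ((excess_mono M.α_ne (edgeClosed_withColor M c) EdgeClosed.univ
        (Set.subset_univ _)).trans (hpl.1 hp).le) (excess_nonneg M.α_ne (edgeClosed_withColor M c))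

theorem leading_of_bridges [Finite H] (hb : ∀ h, M.IsBridge h) :
    M.defect Set.univ = 0 ∧ ∀ c, M.excess (M.withColor c) = 0 := by
  refine ⟨?_, fun c => ?_⟩
  · exact edge_induction (fun R => M.defect R = 0) EdgeClosed.empty EdgeClosed.univ
      (Set.empty_subset _) defect_empty fun R hR _ h _ hhR _ hT =>
        (defect_union_edge_of_not_conn hR ((hb h).not_conn hR hhR)).trans hT
  · exact (excess_eq_of_bridges M.α_ne EdgeClosed.empty (edgeClosed_withColor M c)
      (Set.empty_subset _) fun h _ _ => hb h).trans excess_empty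

end DecoratedMap

/-! ### Isomorphisms -/

section Iso

variable {H H' : Type*}

theorem sameCycle_of_conj [Finite H] (f : H ≃ H') {π : Equiv.Perm H} {π' : Equiv.Perm H'}
    (hf : ∀ x, f (π x) = π' (f x)) {x y : H} (h : π.SameCycle x y) :
    π'.SameCycle (f x) (f y) :=
  sameCycle_induction π (fun z => π'.SameCycle (f x) (f z))
    (fun z hz => by rw [hf]; exact hz.trans (sameCycle_apply_self π' _)) h
    (Equiv.Perm.SameCycle.refl _ _)

theorem conj_symm {α β : Type*} (f : α ≃ β) {π : Equiv.Perm α} {π' : Equiv.Perm β}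
    (hf : ∀ x, f (π x) = π' (f x)) (y : β) : f.symm (π' y) = π (f.symm y) := by
  rw [Equiv.symm_apply_eq, hf, Equiv.apply_symm_apply]

theorem card_cycles_of_conj [Finite H] [Finite H'] (f : H ≃ H') {π : Equiv.Perm H} {π' : Equiv.Perm H'}
    (hf : ∀ x, f (π x) = π' (f x)) :
    Nat.card (Quotient (Equiv.Perm.SameCycle.setoid π)) =
      Nat.card (Quotient (Equiv.Perm.SameCycle.setoid π')) := by
  refine Nat.card_congr (Quotient.congr f fun x y => ⟨sameCycle_of_conj f hf, fun h => ?_⟩)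
  have := sameCycle_of_conj f.symm (conj_symm f hf) h
  rwa [f.symm_apply_apply, f.symm_apply_apply] at this

namespace CombMap

variable {M : CombMap H} {M' : CombMap H'} (f : H ≃ H')

theorem SameComponent.map [Finite H] (hσ : ∀ x, f (M.σ x) = M'.σ (f x)) (hα : ∀ x, f (M.α x) = M'.α (f x))
    {x y : H} (h : M.SameComponent x y) : M'.SameComponent (f x) (f y) :=
  sameComponent_induction M (fun z => M'.SameComponent (f x) (f z))
    (fun z hz => by rw [hσ]; exact hz.trans (sameComponent_σ M' _))
    (fun z hz => by rw [hα]; exact hz.trans (sameComponent_α M' _)) h (SameComponent.refl _ _)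

theorem numComponents_congr [Finite H] [Finite H'] (hσ : ∀ x, f (M.σ x) = M'.σ (f x))
    (hα : ∀ x, f (M.α x) = M'.α (f x)) : M.numComponents = M'.numComponents := by
  rw [numComponents_eq, numComponents_eq]
  refine Nat.card_congr (Quotient.congr f fun x y => ⟨SameComponent.map f hσ hα, fun h => ?_⟩)
  have := SameComponent.map f.symm (conj_symm f hσ) (conj_symm f hα) h
  rwa [f.symm_apply_apply, f.symm_apply_apply] at this

theorem numVertices_congr [Finite H] [Finite H'] (hσ : ∀ x, f (M.σ x) = M'.σ (f x)) : M.numVertices = M'.numVertices :=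
  card_cycles_of_conj f hσ

theorem numFaces_congr [Finite H] [Finite H'] (hσ : ∀ x, f (M.σ x) = M'.σ (f x))
    (hα : ∀ x, f (M.α x) = M'.α (f x)) : M.numFaces = M'.numFaces :=
  card_cycles_of_conj f fun x => by rw [Equiv.Perm.mul_apply, hσ, hα]; rfl

theorem numEdges_congr (hα : ∀ x, f (M.α x) = M'.α (f x)) : M.numEdges = M'.numEdges := by
  rw [numEdges, numEdges, ← Set.ncard_image_of_injective _ f.injective.image_injective]
  congr 1
  ext e
  simp only [Set.mem_image, Set.mem_ofPred_eq]
  constructor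
  · rintro ⟨_, ⟨h, h1, rfl⟩, rfl⟩
    refine ⟨f h, ?_, ?_⟩
    · rw [← hα]; exact fun h2 => h1 (f.injective h2)
    · rw [Set.image_pair, hα]
  · rintro ⟨h, h1, rfl⟩
    refine ⟨{f.symm h, M.α (f.symm h)}, ⟨f.symm h, fun h2 => h1 ?_, rfl⟩, ?_⟩
    · have := hα (f.symm h)
      rwa [h2, f.apply_symm_apply, eq_comm] at this
    · rw [Set.image_pair, hα, f.apply_symm_apply]

theorem sub_α_congr (hα : ∀ x, f (M.α x) = M'.α (f x)) {P : Set H} {P' : Set H'}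
    (hP : M.EdgeClosed P) (hP' : M'.EdgeClosed P') (hPP' : ∀ x, f x ∈ P' ↔ x ∈ P) (x : H) :
    f ((M.sub P).α x) = (M'.sub P').α (f x) := by
  by_cases hx : x ∈ P
  · rw [sub_α_of_mem hP hx, sub_α_of_mem hP' ((hPP' x).2 hx), hα]
  · rw [sub_α_of_notMem hx, sub_α_of_notMem fun h => hx ((hPP' x).1 h)]

end CombMap

namespace DecoratedMap

open CombMap

variable {d : ℕ} {M : DecoratedMap d H} {M' : DecoratedMap d H'}

theorem Isomorphic.leading [Finite H] [Finite H'] (h : M.Isomorphic M') :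
    (M.defect Set.univ = 0 ∧ ∀ c, M.excess (M.withColor c) = 0) ↔
      (M'.defect Set.univ = 0 ∧ ∀ c, M'.excess (M'.withColor c) = 0) := by
  obtain ⟨f, hσ, hα, hc⟩ := h
  have hw : ∀ c x, f x ∈ M'.withColor c ↔ x ∈ M.withColor c := fun c x => by
    change c ∈ (M'.color (f x)).1 ↔ c ∈ (M.color x).1
    rw [hc]
  have hs := fun c => sub_α_congr f hα (edgeClosed_withColor M c) (edgeClosed_withColor M' c) (hw c)
  have h1 := numVertices_congr f hσ
  have h2 := numEdges_congr f hα
  have h3 := numComponents_congr f hσ hα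
  have h4 := fun c => numEdges_congr f (hs c)
  have h5 := fun c => numComponents_congr (M := M.sub (M.withColor c))
    (M' := M'.sub (M'.withColor c)) f hσ (hs c)
  have h6 := fun c => numFaces_congr (M := M.sub (M.withColor c))
    (M' := M'.sub (M'.withColor c)) f hσ (hs c)
  simp only [defect, excess, Set.univ_inter, sub_univ, h1, h2, h3, h4, h5, h6]

theorem Isomorphic.mem_mapSet [Finite H] [Finite H'] {b : ColorSet d → ℕ} (h : M.Isomorphic M') (hM : M ∈ mapSet b H) :
    M' ∈ mapSet b H' := by
  obtain ⟨f, hσ, hα, hc⟩ := h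
  refine ⟨(numComponents_congr f hσ hα).symm.trans hM.1, fun C => ?_⟩
  rw [← hM.2 C, colorSubmap_eq_sub, colorSubmap_eq_sub]
  refine (numEdges_congr f (sub_α_congr f hα (edgeClosed_colored M C) (edgeClosed_colored M' C)
    fun x => ?_)).symm
  change M'.color (f x) = C ↔ M.color x = C
  rw [hc]

end DecoratedMap

end Iso

/-! ### Feynman graphs and their intermediate field maps -/

open CombMap DecoratedMap

variable {d : ℕ} {b : ColorSet d → ℕ}

/-- The intermediate field map of given Wick contractions. -/
def wickMap (wick : BubbleVertex b ≃ BubbleVertex b) : DecoratedMap d (BubbleVertex b) where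
  σ := wick
  α := Equiv.prodCongr (Equiv.refl (Bubble b)) Equiv.boolNot
  α_α := fun x => Prod.ext rfl (Bool.not_not x.2)
  α_ne := fun x e => Bool.not_ne_self x.2 (congrArg Prod.snd e)
  color x := x.1.1
  color_α _ := rfl

/-! ### Bicoloured cycles as faces, and the formula for `δ` -/

theorem ColoredGraph.reachable_edge {K W B : Type} (X : ColoredGraph K W B) {S : Set K} {k : K}
    (hk : k ∈ S) (w : W) : (X.restrict S).Reachable (Sum.inl w) (Sum.inr (X.edge k w)) :=
  SimpleGraph.Adj.reachable ((SimpleGraph.fromRel_adj _ _ _).2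
    ⟨Sum.inl_ne_inr, Or.inl ⟨k, hk, w, rfl, rfl⟩⟩)

/-- A function that takes the same value at the two ends of each edge is constant on components. -/
theorem ColoredGraph.eq_of_reachable {K W B : Type} (X : ColoredGraph K W B) {S : Set K} {A : Type*}
    (f : W ⊕ B → A) (hf : ∀ k ∈ S, ∀ w, f (Sum.inl w) = f (Sum.inr (X.edge k w)))
    {x y : W ⊕ B} (h : (X.restrict S).Reachable x y) : f x = f y := by
  obtain ⟨p⟩ := h
  induction p with
  | nil => rfl
  | cons hadj _ ih =>
    rw [← ih]
    rcases ((SimpleGraph.fromRel_adj _ _ _).1 hadj).2 with ⟨k, hk, w, rfl, rfl⟩ | ⟨k, hk, w, rfl, rfl⟩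
    · exact hf k hk w
    · exact (hf k hk w).symm

variable (wick : BubbleVertex b ≃ BubbleVertex b)

/-- The colour `c` exchanges the canonical pairs of a bubble if `c ∈ C` and otherwise stays within
each pair, just as the edges deleted from the submap become legs. -/
theorem wickGraph_edge_some (c : Fin d) (x : BubbleVertex b) :
    (wickGraph wick).edge (some c) x = ((wickMap wick).sub ((wickMap wick).withColor c)).α x := by
  by_cases hc : c ∈ x.1.1.1
  · rw [sub_α_of_mem (edgeClosed_withColor (wickMap wick) c) hc]
    change (x.1, (if c ∈ x.1.1.1 then Equiv.boolNot else Equiv.refl Bool) x.2) = (x.1, !x.2)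
    rw [if_pos hc]
    rfl
  · rw [sub_α_of_notMem (by exact hc)]
    change (x.1, (if c ∈ x.1.1.1 then Equiv.boolNot else Equiv.refl Bool) x.2) = x
    rw [if_neg hc]
    rfl

/-- From white to white, following colour `c` and then colour `0` is `σ * α` of the submap; every
black vertex is joined to a white one, so components are the cycles of this permutation. -/
theorem card_connectedComponent_wickGraph (c : Fin d) :
    Nat.card ((wickGraph wick).restrict {none, some c}).ConnectedComponent =
      ((wickMap wick).sub ((wickMap wick).withColor c)).numFaces := by
  set N := (wickMap wick).sub ((wickMap wick).withColor c) with hN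
  set X := (wickGraph wick).restrict {none, some c} with hX
  have hnone : ∀ x, X.Reachable (Sum.inl (wick x)) (Sum.inr x) := fun x => by
    have := (wickGraph wick).reachable_edge (S := {none, some c}) (k := none) (by simp) (wick x)
    rwa [show (wickGraph wick).edge none (wick x) = x from wick.symm_apply_apply x] at this
  have hsome : ∀ x, X.Reachable (Sum.inl x) (Sum.inr (N.α x)) := fun x => by
    have := (wickGraph wick).reachable_edge (S := {none, some c}) (k := some c) (by simp) x
    rwa [wickGraph_edge_some] at this
  have hstep : ∀ x, X.Reachable (Sum.inl x) (Sum.inl ((N.σ * N.α) x)) := fun x =>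
    (hsome x).trans (hnone (N.α x)).symm
  have hcycle : ∀ x y, (N.σ * N.α).SameCycle x y → X.Reachable (Sum.inl x) (Sum.inl y) :=
    fun x y h => sameCycle_induction _ (fun z => X.Reachable (Sum.inl x) (Sum.inl z))
      (fun z hz => hz.trans (hstep z)) h (SimpleGraph.Reachable.refl _)
  let g : Quotient (Equiv.Perm.SameCycle.setoid (N.σ * N.α)) → X.ConnectedComponent :=
    Quotient.lift (fun x => X.connectedComponentMk (Sum.inl x))
      fun x y h => SimpleGraph.ConnectedComponent.sound (hcycle x y h)
  refine (Nat.card_congr (Equiv.ofBijective g ⟨?_, ?_⟩)).symm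
  · intro p q hpq
    induction p using Quotient.inductionOn with | _ x
    induction q using Quotient.inductionOn with | _ y
    refine (wickGraph wick).eq_of_reachable (S := {none, some c}) (Sum.elim
      (Quotient.mk (Equiv.Perm.SameCycle.setoid (N.σ * N.α)))
      (fun z => Quotient.mk (Equiv.Perm.SameCycle.setoid (N.σ * N.α)) (wick z))) ?_
      (SimpleGraph.ConnectedComponent.exact hpq)
    rintro k (rfl | rfl) w
    · change Quotient.mk _ w = Quotient.mk _ (wick (wick.symm w))
      rw [wick.apply_symm_apply]
    · rw [wickGraph_edge_some]
      exact Quotient.sound (sameCycle_apply_self (N.σ * N.α) w)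
  · intro q
    induction q using SimpleGraph.ConnectedComponent.ind with | _ v
    rcases v with x | x
    · exact ⟨Quotient.mk _ x, rfl⟩
    · exact ⟨Quotient.mk _ (wick x), SimpleGraph.ConnectedComponent.sound (hnone x)⟩

/-- Each bubble is connected: a colour outside `C` joins the two vertices of a pair, and a colour in
`C` joins the two pairs. -/
theorem wickGraph_connected_iff (hd : 0 < d) :
    ((wickGraph wick).restrict Set.univ).Connected ↔ (wickMap wick).IsConnected := by
  rw [isConnected_iff]
  constructor
  · intro h
    have hne : Nonempty (BubbleVertex b) := by
      obtain ⟨x | x⟩ := h.nonempty <;> exact ⟨x⟩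
    refine ⟨hne, fun x y => ?_⟩
    have := (wickGraph wick).eq_of_reachable (Sum.elim
      (Quotient.mk (componentSetoid (wickMap wick).toCombMap))
      (Quotient.mk (componentSetoid (wickMap wick).toCombMap))) ?_
      (h.preconnected (Sum.inl x) (Sum.inl y))
    · exact Quotient.exact this
    rintro (_ | c) - w
    · refine Quotient.sound ?_
      have := sameComponent_σ (wickMap wick).toCombMap (wick.symm w)
      rw [show (wickMap wick).σ (wick.symm w) = w from wick.apply_symm_apply w] at this
      exact this.symm
    · rw [wickGraph_edge_some]
      refine Quotient.sound (?_ : (wickMap wick).SameComponent _ _)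
      by_cases hw : w ∈ (wickMap wick).withColor c
      · rw [sub_α_of_mem (edgeClosed_withColor _ c) hw]
        exact sameComponent_α _ w
      · rw [sub_α_of_notMem hw]
        exact SameComponent.refl _ w
  · rintro ⟨⟨x₀⟩, h⟩
    set X := (wickGraph wick).restrict Set.univ
    have hnone : ∀ x, X.Reachable (Sum.inl (wick x)) (Sum.inr x) := fun x => by
      have := (wickGraph wick).reachable_edge (S := Set.univ) (k := none) trivial (wick x)
      rwa [show (wickGraph wick).edge none (wick x) = x from wick.symm_apply_apply x] at this
    have hsome : ∀ c x, X.Reachable (Sum.inl x)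
        (Sum.inr (((wickMap wick).sub ((wickMap wick).withColor c)).α x)) := fun c x => by
      have := (wickGraph wick).reachable_edge (S := Set.univ) (k := some c) trivial x
      rwa [wickGraph_edge_some] at this
    have hself : ∀ x, X.Reachable (Sum.inl x) (Sum.inr x) := fun x => by
      have hC := x.1.1.2.2.1
      have : ∃ c, c ∉ x.1.1.1 := by
        by_contra! hall
        rw [Finset.eq_univ_of_forall hall, Finset.card_univ, Fintype.card_fin] at hC
        omega
      obtain ⟨c, hc⟩ := this
      have := hsome c x
      rwa [sub_α_of_notMem (by exact hc)] at this
    have hα : ∀ x, X.Reachable (Sum.inl x) (Sum.inr ((wickMap wick).α x)) := fun x => by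
      obtain ⟨c, hc⟩ := x.1.1.2.1
      have := hsome c x
      rwa [sub_α_of_mem (edgeClosed_withColor _ c) (by exact hc)] at this
    have hall : ∀ x, X.Reachable (Sum.inl x₀) (Sum.inl x) := fun x =>
      sameComponent_induction (wickMap wick).toCombMap
        (fun z => X.Reachable (Sum.inl x₀) (Sum.inl z))
        (fun z hz => hz.trans ((hself z).trans (hnone z).symm))
        (fun z hz => hz.trans ((hα z).trans (hself _).symm)) (h x₀ x)
        (SimpleGraph.Reachable.refl _)
    have hall' : ∀ v, X.Reachable (Sum.inl x₀) v := by
      rintro (x | x)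
      · exact hall x
      · exact (hall x).trans (hself x)
    exact { preconnected := fun u v => (hall' u).symm.trans (hall' v), nonempty := ⟨Sum.inl x₀⟩ }

theorem numEdges_wickMap (p : ColorSet d → Prop) [DecidablePred p] :
    ((wickMap wick).sub {x | p x.1.1}).numEdges = ∑ C, if p C then b C else 0 := by
  have h := two_mul_numEdges (M := (wickMap wick).toCombMap) (P := {x | p x.1.1})
    (wickMap wick).α_ne (fun _ => Iff.rfl)
  have h2 : ({x : BubbleVertex b | p x.1.1} : Set _).ncard = 2 * ∑ C, if p C then b C else 0 := by
    rw [Set.ncard_eq_toFinset_card', Set.toFinset_ofPred, Finset.card_filter,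
      Fintype.sum_prod_type, Fintype.sum_sigma, Finset.mul_sum]
    refine Finset.sum_congr rfl fun C _ => ?_
    by_cases hC : p C <;> simp [hC, mul_comm]
  omega

theorem intermediateField_mem_mapSet (hd : 0 < d) (G : FeynmanGraph b) :
    intermediateField G ∈ mapSet b (BubbleVertex b) := by
  refine ⟨(wickGraph_connected_iff G.wick hd).1 G.connected, fun C => ?_⟩
  rw [colorSubmap_eq_sub]
  refine (numEdges_wickMap G.wick (fun C' => C' = C)).trans ?_
  simp

/-- `totalFaces_eq` with `K = 1` and `E = ∑ C, b C`; counting pairs of an edge and one of its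
colours gives `∑ C, |C| * b C` for the edges of all colour submaps. -/
theorem delta_eq (hd : 0 < d) (s : ColorSet d → ℝ) (G : FeynmanGraph b) :
    delta s G = d + ∑ C, (s C - ((C.1.card : ℝ) - d)) * b C -
      ((intermediateField G).defect Set.univ +
        ∑ c, (intermediateField G).excess ((intermediateField G).withColor c) : ℤ) := by
  have h1 : ∑ c, (G.bicoloredCycles c : ℝ) = ((intermediateField G).totalFaces : ℤ) := by
    rw [totalFaces]
    push_cast
    exact Finset.sum_congr rfl fun c _ =>
      congrArg Nat.cast (card_connectedComponent_wickGraph G.wick c)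
  have h2 : (intermediateField G).numComponents = 1 := (intermediateField_mem_mapSet hd G).1
  have h3 : (intermediateField G).numEdges = ∑ C, b C := by
    have := numEdges_wickMap G.wick fun _ => True
    simp only [if_true] at this
    rw [← this, ← sub_univ (M := (intermediateField G).toCombMap)]
    rfl
  have h4 : ∑ c, (((intermediateField G).sub ((intermediateField G).withColor c)).numEdges : ℤ) =
      ∑ C : ColorSet d, (C.1.card : ℤ) * b C := by
    have h5 : ∀ c, ((intermediateField G).sub ((intermediateField G).withColor c)).numEdges =
        ∑ C : ColorSet d, if c ∈ C.1 then b C else 0 := fun c =>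
      numEdges_wickMap G.wick fun C => c ∈ C.1
    simp only [h5]
    push_cast
    rw [Finset.sum_comm]
    refine Finset.sum_congr rfl fun C _ => ?_
    rw [Finset.sum_ite_mem, Finset.univ_inter, Finset.sum_const, nsmul_eq_mul]
  rw [delta, h1, totalFaces_eq, h2, h3, h4]
  push_cast
  simp only [sub_mul, Finset.sum_sub_distrib, ← Finset.mul_sum]
  ring

theorem excess_intermediateField_nonneg (G : FeynmanGraph b) (c : Fin d) :
    0 ≤ (intermediateField G).excess ((intermediateField G).withColor c) :=
  excess_nonneg (intermediateField G).α_ne (edgeClosed_withColor _ c)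

theorem delta_le (hd : 0 < d) (s : ColorSet d → ℝ) (G : FeynmanGraph b) :
    delta s G ≤ d + ∑ C, (s C - ((C.1.card : ℝ) - d)) * b C := by
  rw [delta_eq hd, sub_le_self_iff]
  exact_mod_cast add_nonneg (defect_nonneg (M := intermediateField G) EdgeClosed.univ)
    (Finset.sum_nonneg fun c _ => excess_intermediateField_nonneg G c)

theorem le_delta_iff (hd : 0 < d) (s : ColorSet d → ℝ) (G : FeynmanGraph b) :
    d + ∑ C, (s C - ((C.1.card : ℝ) - d)) * b C ≤ delta s G ↔
      ((intermediateField G).defect Set.univ = 0 ∧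
        ∀ c, (intermediateField G).excess ((intermediateField G).withColor c) = 0) := by
  have h1 := defect_nonneg (M := intermediateField G) EdgeClosed.univ
  have h2 := Finset.sum_nonneg fun c (_ : c ∈ Finset.univ) => excess_intermediateField_nonneg G c
  have h3 : (∑ c, (intermediateField G).excess ((intermediateField G).withColor c) = 0) ↔
      ∀ c, (intermediateField G).excess ((intermediateField G).withColor c) = 0 := by
    rw [Finset.sum_eq_zero_iff_of_nonneg fun c _ => excess_intermediateField_nonneg G c]
    simp
  rw [delta_eq hd, le_sub_self_iff, ← h3]
  norm_cast
  omega

/-! ### Stars, and surjectivity of the intermediate field -/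

/-- The map in which all the bubbles are leaves around one central vertex. -/
theorem exists_delta_eq (hd : 0 < d) (s : ColorSet d → ℝ) (hb : ∃ C, b C ≠ 0) :
    ∃ G : FeynmanGraph b, delta s G = d + ∑ C, (s C - ((C.1.card : ℝ) - d)) * b C := by
  obtain ⟨C₀, hC₀⟩ := hb
  let i₀ : Bubble b := ⟨C₀, ⟨0, Nat.pos_of_ne_zero hC₀⟩⟩
  -- A cyclic order `ρ` of all bubbles arranges the half-edges `(i, false)` around the centre;
  -- `wick` fixes each `(i, true)`, which makes it a univalent vertex.
  obtain ⟨ρ, hρ, -⟩ := Finset.exists_cycleOn (Finset.univ : Finset (Bubble b))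
  let wick : BubbleVertex b ≃ BubbleVertex b :=
    { toFun := fun x => (if x.2 then x.1 else ρ x.1, x.2)
      invFun := fun x => (if x.2 then x.1 else ρ.symm x.1, x.2)
      left_inv := by rintro ⟨i, _ | _⟩ <;> simp
      right_inv := by rintro ⟨i, _ | _⟩ <;> simp }
  have hf : ∀ i, (wickMap wick).SameComponent (i₀, false) (i, false) := fun i =>
    sameCycle_induction ρ (fun j => (wickMap wick).SameComponent (i₀, false) (j, false))
      (fun j hj => hj.trans (sameComponent_σ (wickMap wick).toCombMap (j, false)))
      (hρ.2 (by simp : i₀ ∈ _) (by simp : i ∈ _)) (SameComponent.refl _ _)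
  have hall : ∀ x, (wickMap wick).SameComponent (i₀, false) x := by
    rintro ⟨i, _ | _⟩
    · exact hf i
    · exact (hf i).trans (sameComponent_α (wickMap wick).toCombMap (i, false))
  have hcon : (wickMap wick).IsConnected :=
    (isConnected_iff _).2 ⟨⟨(i₀, false)⟩, fun x y => (hall x).symm.trans (hall y)⟩
  let G : FeynmanGraph b := ⟨wick, (wickGraph_connected_iff wick hd).2 hcon⟩
  refine ⟨G, le_antisymm (delta_le hd s G) ((le_delta_iff hd s G).2 (leading_of_bridges ?_))⟩
  have hleaf : ∀ i, ∀ P, (wickMap wick).EdgeClosed P → (i, true) ∉ P →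
      ¬ (wickMap wick).Conn P (i, true) (i, false) := by
    intro i P hP hi hc
    have := conn_induction hP (fun x => x = (i, true)) (fun x hx => by rw [hx]; rfl)
      (fun x hxP hx => (hi (hx ▸ hxP)).elim) hc rfl
    simp at this
  rintro ⟨i, _ | _⟩
  · rw [isBridge_iff]
    exact fun hc => hleaf i _ (EdgeClosed.univ.diff (EdgeClosed.edge _))
      (fun h => h.2 (Or.inr rfl)) hc.symm
  · rw [isBridge_iff]
    exact hleaf i _ (EdgeClosed.univ.diff (EdgeClosed.edge _)) (fun h => h.2 (Or.inl rfl))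

/-- Every decorated map is the intermediate field map of a Feynman graph. -/
theorem exists_intermediateField_isomorphic (hd : 0 < d) {H : Type*} [Finite H]
    {M : DecoratedMap d H} (hM : M ∈ mapSet b H) :
    ∃ G : FeynmanGraph b, (intermediateField G).Isomorphic M := by
  let E : ColorSet d → Set (Set H) := fun C =>
    {e : Set H | ∃ h, (M.colorSubmap C).α h ≠ h ∧ e = {h, (M.colorSubmap C).α h}}
  have hcard : ∀ C, Nat.card (E C) = b C := hM.2
  have hE : ∀ C, ∀ e ∈ E C, ∃ h, M.color h = C ∧ e = {h, M.α h} := by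
    rintro C e ⟨h, h1, rfl⟩
    rw [colorSubmap_eq_sub] at h1 ⊢
    have hC : h ∈ M.colored C := by
      by_contra hC
      exact h1 (sub_α_of_notMem hC)
    exact ⟨h, hC, by rw [sub_α_of_mem (edgeClosed_colored M C) hC]⟩
  have hE' : ∀ h, {h, M.α h} ∈ E (M.color h) := fun h => by
    have : (M.colorSubmap (M.color h)).α h = M.α h := by
      rw [colorSubmap_eq_sub, sub_α_of_mem (edgeClosed_colored M _) (by rfl)]
    exact ⟨h, by rw [this]; exact M.α_ne h, by rw [this]⟩
  let eqv : ∀ C, Fin (b C) ≃ E C := fun C => (Finite.equivFinOfCardEq (hcard C)).symm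
  -- The edges of colour set `C` are numbered by `Fin (b C)`; `r` chooses the half of each that
  -- becomes the pair `false` of the bubble.
  choose r hr using fun i : Bubble b => hE i.1 (eqv i.1 i.2).1 (eqv i.1 i.2).2
  let f : BubbleVertex b → H := fun x => if x.2 then M.α (r x.1) else r x.1
  have hfset : ∀ x, ({f x, M.α (f x)} : Set H) = (eqv x.1.1 x.1.2).1 := by
    rintro ⟨i, _ | _⟩
    · exact (hr i).2.symm
    · change ({M.α (r i), M.α (M.α (r i))} : Set H) = _
      rw [M.α_α, Set.pair_comm]
      exact (hr i).2.symm
  have hfcol : ∀ x, M.color (f x) = x.1.1 := by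
    rintro ⟨i, _ | _⟩
    · exact (hr i).1
    · exact (M.color_α _).trans (hr i).1
  have hinj : Function.Injective f := by
    rintro ⟨⟨C, i⟩, e⟩ ⟨⟨C', i'⟩, e'⟩ h
    have h1 := (hfcol ⟨⟨C, i⟩, e⟩).symm.trans ((congrArg M.color h).trans (hfcol ⟨⟨C', i'⟩, e'⟩))
    dsimp only at h1
    subst h1
    have h2 := (hfset ⟨⟨C, i⟩, e⟩).symm.trans
      ((congrArg (fun g => ({g, M.α g} : Set H)) h).trans (hfset ⟨⟨C, i'⟩, e'⟩))
    have h3 : i = i' := (eqv C).injective (Subtype.ext h2)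
    subst h3
    have hne := M.α_ne (r ⟨C, i⟩)
    rcases e with _ | _ <;> rcases e' with _ | _
    · rfl
    · exact (hne h.symm).elim
    · exact (hne h).elim
    · rfl
  have hsurj : Function.Surjective f := by
    intro h
    obtain ⟨i, hi⟩ := (eqv (M.color h)).surjective ⟨_, hE' h⟩
    have h1 := (hr ⟨M.color h, i⟩).2
    rw [hi] at h1
    have h2 : h ∈ ({h, M.α h} : Set H) := by simp
    dsimp only at h1
    rw [h1] at h2
    rcases h2 with h2 | h2
    · exact ⟨(⟨M.color h, i⟩, false), h2.symm⟩
    · exact ⟨(⟨M.color h, i⟩, true), h2.symm⟩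
  let F : BubbleVertex b ≃ H := Equiv.ofBijective f ⟨hinj, hsurj⟩
  let wick : BubbleVertex b ≃ BubbleVertex b := F.trans (M.σ.trans F.symm)
  have hσ : ∀ x, F ((wickMap wick).σ x) = M.σ (F x) := fun x => F.apply_symm_apply _
  have hα : ∀ x, F ((wickMap wick).α x) = M.α (F x) := by
    rintro ⟨i, _ | _⟩
    · rfl
    · exact (M.α_α _).symm
  have hcon : (wickMap wick).IsConnected := (numComponents_congr F hσ hα).trans hM.1
  exact ⟨⟨wick, (wickGraph_connected_iff wick hd).2 hcon⟩, F, hσ, hα, hfcol⟩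

theorem FeynmanGraph.exists_ne_zero (G : FeynmanGraph b) : ∃ C, b C ≠ 0 := by
  have : ∃ x : BubbleVertex b, True := by
    obtain ⟨x | x⟩ := G.connected.nonempty <;> exact ⟨x, trivial⟩
  obtain ⟨⟨⟨C, i⟩, _⟩, -⟩ := this
  exact ⟨C, fun h => (h ▸ i : Fin 0).elim0⟩

/-- The upper bound on `δ` depends only on `b` and is attained, so the maximizers are the graphs
that reach it. -/
theorem mem_graphMax_iff (hd : 0 < d) (s : ColorSet d → ℝ) (G : FeynmanGraph b) :
    G ∈ graphMax s b ↔ d + ∑ C, (s C - ((C.1.card : ℝ) - d)) * b C ≤ delta s G := by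
  constructor
  · intro hG
    obtain ⟨G', hG'⟩ := exists_delta_eq hd s G.exists_ne_zero
    exact hG'.symm.le.trans (hG G')
  · exact fun h G' => (delta_le hd s G').trans h

theorem mem_mapMax_iff (hd : 0 < d) (s : ColorSet d → ℝ) {H : Type*} [Finite H]
    (M : DecoratedMap d H) : M ∈ mapMax s b H ↔ M ∈ mapSet b H ∧
      (M.defect Set.univ = 0 ∧ ∀ c, M.excess (M.withColor c) = 0) := by
  constructor
  · rintro ⟨G, hG, hiso⟩
    exact ⟨hiso.mem_mapSet (intermediateField_mem_mapSet hd G),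
      hiso.leading.1 ((le_delta_iff hd s G).1 ((mem_graphMax_iff hd s G).1 hG))⟩
  · rintro ⟨hM, h0⟩
    obtain ⟨G, hG⟩ := exists_intermediateField_isomorphic hd hM
    exact ⟨G, (mem_graphMax_iff hd s G).2 ((le_delta_iff hd s G).2 (hG.leading.2 h0)), hG⟩

/-! ### The scaling -/

theorem delta_le_of_scaling (hd : 0 < d) {s : ColorSet d → ℝ}
    (hs : ∀ C, s C = (C.1.card : ℝ) - d) (G : FeynmanGraph b) : delta s G ≤ d :=
  (delta_le hd s G).trans (by simp [hs])

theorem exists_delta_eq_of_scaling (hd : 0 < d) {s : ColorSet d → ℝ}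
    (hs : ∀ C, s C = (C.1.card : ℝ) - d) (hb : ∃ C, b C ≠ 0) :
    ∃ G : FeynmanGraph b, delta s G = d := by
  obtain ⟨G, hG⟩ := exists_delta_eq hd s hb
  exact ⟨G, hG.trans (by simp [hs])⟩

theorem isDeltaMax_of_scaling (hd : 2 ≤ d) {s : ColorSet d → ℝ}
    (hs : ∀ C, s C = (C.1.card : ℝ) - d) : IsDeltaMax s d := by
  have hC : IsAdmissible ({⟨0, by omega⟩} : Finset (Fin d)) :=
    ⟨Finset.singleton_nonempty _, by simpa using hd, fun _ => ⟨_, Finset.mem_singleton_self _, rfl⟩⟩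
  obtain ⟨G, hG⟩ := exists_delta_eq_of_scaling (b := fun _ => 1) (by omega) hs
    ⟨⟨_, hC⟩, one_ne_zero⟩
  refine ⟨⟨_, G, hG⟩, ?_⟩
  rintro _ ⟨b, G, rfl⟩
  exact delta_le_of_scaling (by omega) hs G

/-- Put `t C = s C - (|C| - d)`. Stars with many copies of one bubble force `t C ≤ 0` if `δ` is
bounded, while a negative `t C` makes each additional bubble `Q_C` lower the bound. -/
theorem hasNontrivialLargeNLimit_iff (hd : 2 ≤ d) (s : ColorSet d → ℝ) :
    HasNontrivialLargeNLimit s ↔ ∀ C, s C = (C.1.card : ℝ) - d := by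
  have hd0 : 0 < d := by omega
  constructor
  · rintro ⟨q, ⟨-, hq⟩, hlim⟩
    have hsingle : ∀ C (n : ℕ), n ≠ 0 → d + (s C - ((C.1.card : ℝ) - d)) * n ≤ q := by
      intro C n hn
      obtain ⟨G, hG⟩ := exists_delta_eq (b := Pi.single C n) hd0 s ⟨C, by simpa using hn⟩
      refine le_trans (le_of_eq ?_) (hq ⟨_, G, hG⟩)
      rw [Finset.sum_eq_single C]
      · simp
      · intro C' _ hC'
        simp [hC']
      · simp
    have hle : ∀ C, s C - ((C.1.card : ℝ) - d) ≤ 0 := by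
      intro C
      by_contra! hpos
      obtain ⟨n, hn⟩ := exists_nat_gt ((q - d) / (s C - ((C.1.card : ℝ) - d)))
      rw [div_lt_iff₀ hpos] at hn
      have h1 := hsingle C (n + 1) (Nat.succ_ne_zero n)
      push_cast at h1
      linarith
    intro C
    -- A leading graph with at least two bubbles `Q_C` gives `q ≤ d + 2 t`, a star with one gives `d
    -- + t ≤ q`; together `t ≥ 0`.
    obtain ⟨b, G, hn, hG⟩ := hlim C 2
    have h1 := hsingle C 1 one_ne_zero
    have h2 := delta_le hd0 s G
    have h3 : ∑ C', (s C' - ((C'.1.card : ℝ) - d)) * b C' ≤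
        (s C - ((C.1.card : ℝ) - d)) * b C := by
      rw [← Finset.add_sum_erase _ _ (Finset.mem_univ C), add_le_iff_nonpos_right]
      exact Finset.sum_nonpos fun C' _ =>
        mul_nonpos_of_nonpos_of_nonneg (hle C') (Nat.cast_nonneg _)
    have h4 : (s C - ((C.1.card : ℝ) - d)) * b C ≤ (s C - ((C.1.card : ℝ) - d)) * 2 :=
      mul_le_mul_of_nonpos_left (by exact_mod_cast hn) (hle C)
    have h5 := hle C
    push_cast at h1
    linarith
  · intro hs
    refine ⟨d, isDeltaMax_of_scaling hd hs, fun C n => ?_⟩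
    obtain ⟨G, hG⟩ := exists_delta_eq_of_scaling (b := fun _ => n + 1) hd0 hs
      ⟨C, Nat.succ_ne_zero n⟩
    exact ⟨_, G, Nat.le_succ n, hG⟩

end QuarticTensor

theorem mainTheorem3 (d : ℕ) (hd : 3 ≤ d) :
    (∀ s : QuarticTensor.ColorSet d → ℝ,
      QuarticTensor.HasNontrivialLargeNLimit s ↔
        ∀ C : QuarticTensor.ColorSet d, s C = (C.1.card : ℝ) - (d : ℝ)) ∧
    (∀ s : QuarticTensor.ColorSet d → ℝ, QuarticTensor.HasNontrivialLargeNLimit s →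
      QuarticTensor.IsDeltaMax s (d : ℝ) ∧
        ∀ (b : QuarticTensor.ColorSet d → ℕ), ∀ G ∈ QuarticTensor.graphMax s b,
          QuarticTensor.delta s G = (d : ℝ)) ∧
    (∀ (s : QuarticTensor.ColorSet d → ℝ) (b : QuarticTensor.ColorSet d → ℕ)
      (H : Type*) [Finite H] (M : QuarticTensor.DecoratedMap d H),
      M ∈ QuarticTensor.mapMax s b H ↔
        M ∈ QuarticTensor.mapSet b H ∧
        M.IsPlanar ∧
        (∀ h : H, 2 * (M.color h).1.card < d → M.IsBridge h) ∧
        (∀ C : QuarticTensor.ColorSet d, (M.colorSubmap C).IsPlanar) ∧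
        (∀ C C' : QuarticTensor.ColorSet d, C ≠ C' → M.MeetOnlyAtCutVertices C C')) := by
  have hd0 : 0 < d := by omega
  refine ⟨QuarticTensor.hasNontrivialLargeNLimit_iff (by omega), fun s hs => ?_,
    fun s b H _ M => (QuarticTensor.mem_mapMax_iff hd0 s M).trans
      (and_congr_right fun _ => QuarticTensor.DecoratedMap.leading_iff hd0)⟩
  rw [QuarticTensor.hasNontrivialLargeNLimit_iff (by omega)] at hs
  refine ⟨QuarticTensor.isDeltaMax_of_scaling (by omega) hs, fun b G hG => ?_⟩
  refine le_antisymm (QuarticTensor.delta_le_of_scaling hd0 hs G) ?_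
  obtain ⟨G', hG'⟩ := QuarticTensor.exists_delta_eq_of_scaling hd0 hs G.exists_ne_zero
  exact hG'.symm.le.trans (hG G')
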